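/- There is a function $D:\mathbb N\to\mathbb N$ with $D(n)=O\big((\log n)^{2.799}\big)$ as $n\to\infty$ such that, for every $n\ge 0$ and every $W\in SU(2)$, the $n$-controlled gate $C^nW$ (the unitary on $n+1$ qubits that applies $W$ to the target qubit if all $n$ control qubits are in state $|1\rangle$ and acts as the identity otherwise) is implemented exactly by a quantum circuit of depth at most $D(n)$ that consists of single-qubit unitary gates and CNOT gates and acts only on these $n+1$ qubits (no further ancilla). Here the depth of a circuit is the number of its layers, a layer being a set of gates that act on pairwise disjoint sets of qubits. -/

import Mathlib

open Asymptotics Filter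

noncomputable section

/-- The matrix, in the computational basis `ι → Fin 2` of a register of qubits labelled by `ι`, of
the gate that applies `U` to the qubit `target` when every qubit in `controls` is in state `1`, and
acts as the identity otherwise.  The row index is the output basis state, the column index the
input basis state.  (Meaningful when `target ∉ controls`.) -/
def controlledGate {ι : Type} [Fintype ι] [DecidableEq ι] (controls : Finset ι) (target : ι)
    (U : Matrix (Fin 2) (Fin 2) ℂ) : Matrix (ι → Fin 2) (ι → Fin 2) ℂ :=
  fun x y =>
    if ∀ j, j ≠ target → x j = y j then
      (if ∀ c ∈ controls, y c = 1 then U (x target) (y target)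
        else (1 : Matrix (Fin 2) (Fin 2) ℂ) (x target) (y target))
    else 0

/-- The Pauli matrix `X` (the NOT gate). -/
def pauliX : Matrix (Fin 2) (Fin 2) ℂ := !![0, 1; 1, 0]

/-- The elementary gates: arbitrary single-qubit unitaries and CNOT gates. -/
inductive ElemGate (ι : Type) : Type where
  | single (q : ι) (U : Matrix.unitaryGroup (Fin 2) ℂ) : ElemGate ι
  | cnot (c t : ι) (h : c ≠ t) : ElemGate ι

namespace ElemGate

variable {ι : Type} [DecidableEq ι]

/-- The set of qubits on which an elementary gate acts. -/
def qubits : ElemGate ι → Finset ι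
  | single q _ => {q}
  | cnot c t _ => {c, t}

/-- The matrix of an elementary gate on the whole register. -/
def toMatrix [Fintype ι] : ElemGate ι → Matrix (ι → Fin 2) (ι → Fin 2) ℂ
  | single q U => controlledGate ∅ q (U : Matrix (Fin 2) (Fin 2) ℂ)
  | cnot c t _ => controlledGate {c} t pauliX

end ElemGate

/-- A layer: elementary gates acting on pairwise disjoint sets of qubits, executed in parallel. -/
structure CircuitLayer (ι : Type) [DecidableEq ι] : Type where
  gates : List (ElemGate ι)
  disjoint : gates.Pairwise (fun g h => Disjoint g.qubits h.qubits)

/-- The matrix of a layer (its gates commute, so the order of the product is immaterial). -/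
def CircuitLayer.toMatrix {ι : Type} [Fintype ι] [DecidableEq ι] (L : CircuitLayer ι) :
    Matrix (ι → Fin 2) (ι → Fin 2) ℂ :=
  (L.gates.map ElemGate.toMatrix).prod

/-- A quantum circuit over single-qubit and CNOT gates, as a sequence of layers.  The first layer
of the list is executed first. -/
abbrev QCircuit (ι : Type) [DecidableEq ι] : Type := List (CircuitLayer ι)

/-- The depth of a circuit: its number of layers. -/
def QCircuit.depth {ι : Type} [DecidableEq ι] (C : QCircuit ι) : ℕ := List.length C

/-- The matrix implemented by a circuit. -/
def QCircuit.toMatrix {ι : Type} [Fintype ι] [DecidableEq ι] :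
    QCircuit ι → Matrix (ι → Fin 2) (ι → Fin 2) ℂ
  | [] => 1
  | L :: C => QCircuit.toMatrix C * L.toMatrix

/-- The `n`-controlled `W` gate `C^n W` on `n + 1` qubits: the qubits `0, …, n - 1` are the
controls and the last qubit is the target. -/
def multiControlled (n : ℕ) (W : Matrix (Fin 2) (Fin 2) ℂ) :
    Matrix (Fin (n + 1) → Fin 2) (Fin (n + 1) → Fin 2) ℂ :=
  controlledGate (Finset.univ.erase (Fin.last n)) (Fin.last n) W

end

/-! The construction has depth quadratic in `log n`, which is below the required power.

Every W in SU(2) is diagonal in some orthonormal basis with entries u² and its inverse, hence W =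
PQPQ for two reflections P, Q, each a unitary conjugate of X (`exists_reflections`). As P and Q are
involutions, the word PQPQ becomes trivial as soon as one of the letters is dropped. So with P
controlled on one half of the controls and Q on the other half, the word is controlled on all of
them (`controlledGate_union_eq`). It remains to implement NOT gates controlled on about n/2 bits,
and the idle half supplies dirty bits, whose values are unknown but restored.

On bit strings, viewed as vectors over the field with two elements, such a gate adds a product of
bits to t. With as many clean (zero) ancillas as controls, a binary tree of Toffoli gates computes
the product in logarithmic depth (`exists_clean_toggle`). Clean bits are produced from the controls:
once the conjunction of a block P of controls is stored in a flag z, negating P gives bits that are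
zero whenever z = 1. If z = 0 the final product vanishes anyway, so bits clean only under this
condition suffice. Each stage roughly doubles the stock of such bits, so about log n stages of depth
O(log n) reduce the problem to O(log n) flags (`exists_conditional_toggle`). The flags are handled
by a divide-and-conquer gate of quadratic depth in their number, using two dirty bits
(`permImplementable_toggle_dirty`).

The recursion starts from three controls A, negated so that they are clean if all were 1. The
dependence on this condition is removed by applying the construction twice, with a dirty bit d as
first flag and d flipped in between exactly when A is all ones (`permImplementable_toggle`). -/

noncomputable section

/-! ### Operators acting on one qubit, conditioned on the others -/

section BlockMatrices

variable {ι : Type} [DecidableEq ι]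

/-- `u` does not depend on the value of the qubit `t`. -/
def IndepOf {β : Type*} (t : ι) (u : (ι → Fin 2) → β) : Prop :=
  ∀ x b, u (Function.update x t b) = u x

lemma eq_update_of_agree {t : ι} {x y : ι → Fin 2} (h : ∀ j, j ≠ t → x j = y j) :
    y = Function.update x t (y t) := by
  ext j
  by_cases hj : j = t
  · subst hj; simp
  · simp [hj, h j hj]

lemma controls_update {S : Finset ι} {t : ι} (ht : t ∉ S) (x : ι → Fin 2) (b : Fin 2) :
    (∀ c ∈ S, Function.update x t b c = 1) ↔ ∀ c ∈ S, x c = 1 := by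
  refine forall₂_congr fun c hc => ?_
  rw [Function.update_of_ne (ne_of_mem_of_not_mem hc ht)]

lemma indepOf_controls {β : Type*} {S : Finset ι} {t : ι} (ht : t ∉ S) (U V : β)
    [∀ y : ι → Fin 2, Decidable (∀ c ∈ S, y c = 1)] :
    IndepOf t (fun y : ι → Fin 2 => if ∀ c ∈ S, y c = 1 then U else V) := by
  intro x b
  simp only [controls_update ht]

variable [Fintype ι]

/-- The operator acting on the qubit `t` by the matrix `u y`, which may depend on the basis state
`y` of the other qubits. -/
def blockGate (t : ι) (u : (ι → Fin 2) → Matrix (Fin 2) (Fin 2) ℂ) :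
    Matrix (ι → Fin 2) (ι → Fin 2) ℂ :=
  fun x y => if ∀ j, j ≠ t → x j = y j then u y (x t) (y t) else 0

/-- Only the two basis states that agree with x off t contribute. Working with the action on vectors
avoids double sums over the register in the product and commutation rules below. -/
lemma blockGate_mulVec {t : ι} {u : (ι → Fin 2) → Matrix (Fin 2) (Fin 2) ℂ} (hu : IndepOf t u)
    (f : (ι → Fin 2) → ℂ) (x : ι → Fin 2) :
    (blockGate t u).mulVec f x = ∑ b, u x (x t) b * f (Function.update x t b) := by
  have key : ∑ y ∈ Finset.univ.image (fun b => Function.update x t b), blockGate t u x y * f y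
      = ∑ y, blockGate t u x y * f y := by
    apply Finset.sum_subset (Finset.subset_univ _)
    intro y _ hy
    have : ¬ ∀ j, j ≠ t → x j = y j := by
      intro h
      apply hy
      rw [Finset.mem_image]
      exact ⟨y t, Finset.mem_univ _, (eq_update_of_agree h).symm⟩
    simp only [blockGate, if_neg this, zero_mul]
  rw [Matrix.mulVec, dotProduct, ← key, Finset.sum_image]
  · refine Finset.sum_congr rfl fun b _ => ?_
    have : ∀ j, j ≠ t → x j = Function.update x t b j := by
      intro j hj
      simp [hj]
    simp only [blockGate, if_pos this, hu x b, Function.update_self]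
  · intro b _ b' _ h
    simpa using congrFun h t

lemma matrix_ext_mulVec {α : Type*} [Fintype α] [DecidableEq α] {M N : Matrix α α ℂ}
    (h : ∀ f, M.mulVec f = N.mulVec f) : M = N := by
  ext i j
  have := congrFun (h (Pi.single j 1)) i
  simpa using this

lemma blockGate_mul {t : ι} {u v : (ι → Fin 2) → Matrix (Fin 2) (Fin 2) ℂ} (hu : IndepOf t u)
    (hv : IndepOf t v) : blockGate t u * blockGate t v = blockGate t (fun x => u x * v x) := by
  apply matrix_ext_mulVec
  intro f
  ext x
  rw [← Matrix.mulVec_mulVec, blockGate_mulVec hu,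
    blockGate_mulVec (fun x b => by rw [hu x b, hv x b])]
  simp only [blockGate_mulVec hv, hv x, Function.update_self, Function.update_idem,
    Matrix.mul_apply, Fin.sum_univ_two]
  ring

lemma blockGate_comm {t s : ι} (hts : t ≠ s) {u v : (ι → Fin 2) → Matrix (Fin 2) (Fin 2) ℂ}
    (hu : IndepOf t u) (hv : IndepOf s v) (hus : IndepOf s u) (hvt : IndepOf t v) :
    blockGate t u * blockGate s v = blockGate s v * blockGate t u := by
  apply matrix_ext_mulVec
  intro f
  ext x
  rw [← Matrix.mulVec_mulVec, ← Matrix.mulVec_mulVec, blockGate_mulVec hu, blockGate_mulVec hv]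
  simp only [blockGate_mulVec hv, blockGate_mulVec hu, hvt x, hus x,
    Function.update_of_ne hts, Function.update_of_ne hts.symm, Finset.mul_sum]
  rw [Finset.sum_comm]
  refine Finset.sum_congr rfl fun b _ => Finset.sum_congr rfl fun b' _ => ?_
  rw [Function.update_comm hts]
  ring

lemma controlledGate_eq_blockGate (S : Finset ι) (t : ι) (U : Matrix (Fin 2) (Fin 2) ℂ) :
    controlledGate S t U = blockGate t (fun y => if ∀ c ∈ S, y c = 1 then U else 1) := by
  ext x y
  simp only [controlledGate, blockGate]
  split_ifs <;> rfl

lemma controlledGate_comm {S S' : Finset ι} {t t' : ι} {U U' : Matrix (Fin 2) (Fin 2) ℂ}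
    (ht : t ∉ S) (ht' : t' ∉ S') (h : Disjoint (insert t S) (insert t' S')) :
    controlledGate S t U * controlledGate S' t' U' =
      controlledGate S' t' U' * controlledGate S t U := by
  rw [Finset.disjoint_left] at h
  rw [controlledGate_eq_blockGate, controlledGate_eq_blockGate]
  refine blockGate_comm ?_ (indepOf_controls ht _ _) (indepOf_controls ht' _ _)
    (indepOf_controls ?_ _ _) (indepOf_controls ?_ _ _)
  · rintro rfl
    exact h (Finset.mem_insert_self _ _) (Finset.mem_insert_self _ _)
  · intro hs
    exact h (Finset.mem_insert_of_mem hs) (Finset.mem_insert_self _ _)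
  · intro hs
    exact h (Finset.mem_insert_self _ _) (Finset.mem_insert_of_mem hs)

lemma ElemGate.toMatrix_comm {g h : ElemGate ι} (hd : Disjoint g.qubits h.qubits) :
    g.toMatrix * h.toMatrix = h.toMatrix * g.toMatrix := by
  have key : ∀ g : ElemGate ι, ∃ S t U, t ∉ S ∧ g.qubits = insert t S ∧
      g.toMatrix = controlledGate S t U := by
    rintro (⟨q, U⟩ | ⟨c, t, hct⟩)
    · exact ⟨∅, q, U, by simp, by simp [ElemGate.qubits], rfl⟩
    · exact ⟨{c}, t, pauliX, by simpa using hct.symm,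
        by simp [ElemGate.qubits, Finset.pair_comm], rfl⟩
  obtain ⟨S, t, U, ht, hq, hm⟩ := key g
  obtain ⟨S', t', U', ht', hq', hm'⟩ := key h
  rw [hm, hm']
  exact controlledGate_comm ht ht' (hq ▸ hq' ▸ hd)

end BlockMatrices

/-! ### Composition of circuits in sequence and in parallel -/

section Circuits

variable {ι : Type} [Fintype ι] [DecidableEq ι]

/-- All gates of the circuit act inside `A`. -/
def QCircuit.SupportedOn (A : Finset ι) (C : QCircuit ι) : Prop :=
  ∀ L ∈ C, ∀ g ∈ L.gates, g.qubits ⊆ A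

/-- `M` is implemented by a circuit of depth at most `D` whose gates act inside `A`. -/
def Implementable (A : Finset ι) (D : ℕ) (M : Matrix (ι → Fin 2) (ι → Fin 2) ℂ) : Prop :=
  ∃ C : QCircuit ι, C.SupportedOn A ∧ C.toMatrix = M ∧ C.depth ≤ D

lemma QCircuit.toMatrix_append (C C' : QCircuit ι) :
    QCircuit.toMatrix (C ++ C') = QCircuit.toMatrix C' * QCircuit.toMatrix C := by
  induction C with
  | nil => simp [QCircuit.toMatrix]
  | cons L C ih => rw [List.cons_append, QCircuit.toMatrix, ih, QCircuit.toMatrix, mul_assoc]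

lemma Implementable.mono {A B : Finset ι} {D D' : ℕ} {M : Matrix (ι → Fin 2) (ι → Fin 2) ℂ}
    (h : Implementable A D M) (hA : A ⊆ B) (hD : D ≤ D') : Implementable B D' M := by
  obtain ⟨C, hC, hM, hd⟩ := h
  exact ⟨C, fun L hL g hg => (hC L hL g hg).trans hA, hM, hd.trans hD⟩

lemma Implementable.one (A : Finset ι) : Implementable A 0 1 :=
  ⟨[], by simp [QCircuit.SupportedOn], rfl, le_rfl⟩

lemma Implementable.mul {A : Finset ι} {D D' : ℕ} {M M' : Matrix (ι → Fin 2) (ι → Fin 2) ℂ}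
    (h : Implementable A D M) (h' : Implementable A D' M') :
    Implementable A (D + D') (M * M') := by
  obtain ⟨C, hC, hM, hd⟩ := h
  obtain ⟨C', hC', hM', hd'⟩ := h'
  refine ⟨C' ++ C, ?_, by rw [QCircuit.toMatrix_append, hM, hM'], ?_⟩
  · intro L hL
    rcases List.mem_append.1 hL with hL | hL
    exacts [hC' L hL, hC L hL]
  · simp only [QCircuit.depth, List.length_append] at *
    omega

lemma commute_layer {A B : Finset ι} (hAB : Disjoint A B) {L L' : CircuitLayer ι}
    (hL : ∀ g ∈ L.gates, g.qubits ⊆ A) (hL' : ∀ g ∈ L'.gates, g.qubits ⊆ B) :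
    Commute L.toMatrix L'.toMatrix := by
  refine Commute.list_prod_left _ _ fun M hM => Commute.list_prod_right _ _ fun M' hM' => ?_
  obtain ⟨g, hg, rfl⟩ := List.mem_map.1 hM
  obtain ⟨g', hg', rfl⟩ := List.mem_map.1 hM'
  exact ElemGate.toMatrix_comm (Finset.disjoint_of_subset_left (hL g hg)
    (Finset.disjoint_of_subset_right (hL' g' hg') hAB))

lemma commute_layer_circuit {A B : Finset ι} (hAB : Disjoint A B) {L : CircuitLayer ι}
    {C : QCircuit ι} (hL : ∀ g ∈ L.gates, g.qubits ⊆ A) (hC : C.SupportedOn B) :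
    Commute L.toMatrix (QCircuit.toMatrix C) := by
  induction C with
  | nil => exact Commute.one_right _
  | cons L' C ih =>
    rw [QCircuit.toMatrix]
    exact (ih fun K hK => hC K (List.mem_cons_of_mem _ hK)).mul_right
      (commute_layer hAB hL (hC L' List.mem_cons_self))

/-- The circuits are merged layer by layer. Layers with disjoint supports commute, so `L'`, L and
the remaining layers can be reordered; the longer circuit continues alone at the end. -/
lemma QCircuit.exists_parallel {A B : Finset ι} (hAB : Disjoint A B) (C C' : QCircuit ι)
    (hC : C.SupportedOn A) (hC' : C'.SupportedOn B) :
    ∃ P : QCircuit ι, P.SupportedOn (A ∪ B) ∧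
      P.toMatrix = QCircuit.toMatrix C * QCircuit.toMatrix C' ∧
      P.depth ≤ max C.depth C'.depth := by
  induction C generalizing C' with
  | nil =>
    exact ⟨C', fun L hL g hg => (hC' L hL g hg).trans Finset.subset_union_right,
      by simp [QCircuit.toMatrix], by simp⟩
  | cons L C ih =>
    cases C' with
    | nil =>
      exact ⟨L :: C, fun L hL g hg => (hC L hL g hg).trans Finset.subset_union_left,
        by simp [QCircuit.toMatrix], by simp⟩
    | cons L' C' =>
      have hL := hC L List.mem_cons_self
      have hL' := hC' L' List.mem_cons_self
      have hCt : QCircuit.SupportedOn A C := fun K hK => hC K (List.mem_cons_of_mem _ hK)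
      have hCt' : QCircuit.SupportedOn B C' := fun K hK => hC' K (List.mem_cons_of_mem _ hK)
      obtain ⟨P, hP, hM, hd⟩ := ih C' hCt hCt'
      refine ⟨⟨L.gates ++ L'.gates, ?_⟩ :: P, ?_, ?_, ?_⟩
      · rw [List.pairwise_append]
        exact ⟨L.disjoint, L'.disjoint, fun g hg g' hg' =>
          Finset.disjoint_of_subset_left (hL g hg)
            (Finset.disjoint_of_subset_right (hL' g' hg') hAB)⟩
      · intro K hK
        rcases List.mem_cons.1 hK with rfl | hK
        · intro g hg
          rcases List.mem_append.1 hg with hg | hg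
          · exact (hL g hg).trans Finset.subset_union_left
          · exact (hL' g hg).trans Finset.subset_union_right
        · exact hP K hK
      · have hmul : CircuitLayer.toMatrix ⟨L.gates ++ L'.gates, by
            rw [List.pairwise_append]
            exact ⟨L.disjoint, L'.disjoint, fun g hg g' hg' =>
              Finset.disjoint_of_subset_left (hL g hg)
                (Finset.disjoint_of_subset_right (hL' g' hg') hAB)⟩⟩ =
            L.toMatrix * L'.toMatrix := by
          simp [CircuitLayer.toMatrix]
        rw [QCircuit.toMatrix, hM, hmul, QCircuit.toMatrix, QCircuit.toMatrix]
        have := (commute_layer_circuit hAB hL hCt').eq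
        rw [mul_assoc, ← mul_assoc (QCircuit.toMatrix C'), ← this]
        simp only [mul_assoc]
      · simp only [QCircuit.depth, List.length_cons] at *
        omega

lemma Implementable.parallel {A B : Finset ι} (hAB : Disjoint A B) {D : ℕ}
    {M M' : Matrix (ι → Fin 2) (ι → Fin 2) ℂ} (h : Implementable A D M)
    (h' : Implementable B D M') : Implementable (A ∪ B) D (M * M') := by
  obtain ⟨C, hC, hM, hd⟩ := h
  obtain ⟨C', hC', hM', hd'⟩ := h'
  obtain ⟨P, hP, hPM, hPd⟩ := QCircuit.exists_parallel hAB C C' hC hC'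
  exact ⟨P, hP, by rw [hPM, hM, hM'], hPd.trans (max_le hd hd')⟩

lemma ElemGate.implementable {A : Finset ι} (g : ElemGate ι) (hg : g.qubits ⊆ A) :
    Implementable A 1 g.toMatrix := by
  refine ⟨[⟨[g], by simp⟩], ?_, ?_, le_rfl⟩
  · intro L hL g' hg'
    simp only [List.mem_singleton] at hL
    subst hL
    simp only [List.mem_singleton] at hg'
    exact hg' ▸ hg
  · simp [QCircuit.toMatrix, CircuitLayer.toMatrix]

lemma implementable_single {A : Finset ι} {q : ι} (hq : q ∈ A)
    {U : Matrix (Fin 2) (Fin 2) ℂ} (hU : U ∈ Matrix.unitaryGroup (Fin 2) ℂ) :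
    Implementable A 1 (controlledGate ∅ q U) :=
  (ElemGate.single q ⟨U, hU⟩).implementable (by simpa [ElemGate.qubits] using hq)

lemma implementable_cnot {A : Finset ι} {c t : ι} (hct : c ≠ t) (hc : c ∈ A) (ht : t ∈ A) :
    Implementable A 1 (controlledGate {c} t pauliX) :=
  (ElemGate.cnot c t hct).implementable (by
    intro q hq
    simp only [ElemGate.qubits, Finset.mem_insert, Finset.mem_singleton] at hq
    rcases hq with rfl | rfl <;> assumption)

end Circuits

/-! ### Reversible maps on bit strings and their permutation matrices -/

section PermGates

variable {ι : Type}

/-- The conjunction of the bits in `S`. -/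
def allOnes (S : Finset ι) (x : ι → Fin 2) : Fin 2 := if ∀ c ∈ S, x c = 1 then 1 else 0

lemma allOnes_eq_one {S : Finset ι} {x : ι → Fin 2} : allOnes S x = 1 ↔ ∀ c ∈ S, x c = 1 := by
  unfold allOnes
  split_ifs with h
  · simpa using h
  · simpa using h

lemma allOnes_eq_zero {S : Finset ι} {x : ι → Fin 2} (h : ¬ ∀ c ∈ S, x c = 1) : allOnes S x = 0 :=
  if_neg h

lemma allOnes_congr {S : Finset ι} {x y : ι → Fin 2} (h : ∀ c ∈ S, x c = y c) :
    allOnes S x = allOnes S y := by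
  unfold allOnes
  congr 1
  exact propext (forall₂_congr fun c hc => by rw [h c hc])

lemma fin_two_eq_of_iff {a b : Fin 2} (h : a = 1 ↔ b = 1) : a = b := by
  revert a b; decide

lemma allOnes_empty (x : ι → Fin 2) : allOnes ∅ x = 1 := by simp [allOnes]

lemma allOnes_singleton (a : ι) (x : ι → Fin 2) : allOnes {a} x = x a :=
  fin_two_eq_of_iff (by simp [allOnes_eq_one])

variable [DecidableEq ι]

lemma allOnes_update {S : Finset ι} {t : ι} (ht : t ∉ S) (x : ι → Fin 2) (b : Fin 2) :
    allOnes S (Function.update x t b) = allOnes S x :=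
  allOnes_congr fun _ hc => Function.update_of_ne (ne_of_mem_of_not_mem hc ht) _ _

lemma allOnes_union (S T : Finset ι) (x : ι → Fin 2) : allOnes (S ∪ T) x = allOnes S x * allOnes T x := by
  by_cases hS : ∀ c ∈ S, x c = 1
  · by_cases hT : ∀ c ∈ T, x c = 1
    · rw [allOnes_eq_one.2 hS, allOnes_eq_one.2 hT, mul_one, allOnes_eq_one]
      intro c hc
      exact (Finset.mem_union.1 hc).elim (hS c) (hT c)
    · rw [allOnes_eq_zero hT, mul_zero, allOnes_eq_zero]
      exact fun h => hT fun c hc => h c (Finset.mem_union_right _ hc)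
  · rw [allOnes_eq_zero hS, zero_mul, allOnes_eq_zero]
    exact fun h => hS fun c hc => h c (Finset.mem_union_left _ hc)

lemma allOnes_insert (a : ι) (S : Finset ι) (x : ι → Fin 2) :
    allOnes (insert a S) x = x a * allOnes S x := by
  rw [Finset.insert_eq, allOnes_union, allOnes_singleton]

lemma fin_two_add_self_right (a b : Fin 2) : a + b + b = a := by
  revert a b; decide

/-- Adds `g x` to the bit `t`. -/
def xorAt (t : ι) (g : (ι → Fin 2) → Fin 2) (x : ι → Fin 2) : ι → Fin 2 :=
  Function.update x t (x t + g x)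

lemma xorAt_involutive {t : ι} {g : (ι → Fin 2) → Fin 2} (hg : IndepOf t g) :
    Function.Involutive (xorAt t g) := by
  intro x
  simp [xorAt, hg x, fin_two_add_self_right]

/-- The multi-controlled NOT gate with controls `S \ {t}` and target `t`, on bit strings. -/
def toggle (S : Finset ι) (t : ι) : Equiv.Perm (ι → Fin 2) :=
  -- Erasing t keeps the map an involution for every S, so no hypothesis t ∉ S is needed in the
  -- definition.
  (xorAt_involutive (g := allOnes (S.erase t))
    (fun x b => allOnes_update (Finset.notMem_erase t S) x b)).toPerm

lemma toggle_apply {S : Finset ι} {t : ι} (ht : t ∉ S) (x : ι → Fin 2) :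
    toggle S t x = Function.update x t (x t + allOnes S x) := by
  simp [toggle, xorAt, Finset.erase_eq_of_notMem ht]

lemma toggle_apply_self {S : Finset ι} {t : ι} (ht : t ∉ S) (x : ι → Fin 2) :
    toggle S t x t = x t + allOnes S x := by
  simp [toggle_apply ht]

lemma toggle_apply_of_ne {S : Finset ι} {t q : ι} (hq : q ≠ t) (x : ι → Fin 2) :
    toggle S t x q = x q := by
  simp [toggle, xorAt, hq]

lemma toggle_toggle (S : Finset ι) (t : ι) (x : ι → Fin 2) :
    toggle S t (toggle S t x) = x :=
  xorAt_involutive (fun x b => allOnes_update (Finset.notMem_erase t S) x b) x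

lemma toggle_inv (S : Finset ι) (t : ι) : (toggle S t)⁻¹ = toggle S t := by
  apply inv_eq_of_mul_eq_one_left
  ext1 x
  exact toggle_toggle S t x

variable [Fintype ι]

/-- The permutation matrix of a classical reversible circuit. -/
def permGate (σ : Equiv.Perm (ι → Fin 2)) : Matrix (ι → Fin 2) (ι → Fin 2) ℂ :=
  fun x y => if σ y = x then 1 else 0

omit [DecidableEq ι] in
lemma permGate_one : permGate (1 : Equiv.Perm (ι → Fin 2)) = 1 := by
  ext x y
  simp [permGate, Matrix.one_apply, eq_comm]

lemma permGate_mul (σ τ : Equiv.Perm (ι → Fin 2)) :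
    permGate (σ * τ) = permGate σ * permGate τ := by
  ext x y
  simp only [permGate, Matrix.mul_apply, Equiv.Perm.mul_apply, mul_ite, mul_one, mul_zero]
  rw [Finset.sum_eq_single (τ y)]
  · rw [if_pos rfl]
    congr
  · intro z _ hz
    rw [if_neg hz.symm]
  · simp

/-- Phases that depend on sums of bits come from single-qubit phases by conjugation with CNOT gates.
-/
lemma permGate_conj_diagonal (σ : Equiv.Perm (ι → Fin 2)) (φ : (ι → Fin 2) → ℂ) :
    permGate σ⁻¹ * Matrix.diagonal φ * permGate σ = Matrix.diagonal (fun x => φ (σ x)) := by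
  ext x y
  rw [mul_assoc, Matrix.mul_apply, Finset.sum_eq_single (σ x)]
  · rw [Matrix.diagonal_mul]
    by_cases h : x = y
    · subst h; simp [permGate]
    · have : ¬ σ y = σ x := fun h' => h (σ.injective h').symm
      simp [permGate, this, h]
  · intro z _ hz
    have : permGate σ⁻¹ x z = 0 := if_neg (by rintro rfl; simp at hz)
    rw [this, zero_mul]
  · simp

lemma controlledGate_pauliX {S : Finset ι} {t : ι} (ht : t ∉ S) :
    controlledGate S t pauliX = permGate (toggle S t) := by
  ext x y
  simp only [controlledGate, permGate, toggle_apply ht]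
  by_cases h : ∀ j, j ≠ t → x j = y j
  · rw [if_pos h]
    have hx : ∀ b : Fin 2, Function.update y t b = x ↔ b = x t := by
      intro b
      refine ⟨fun h => by simp [← h], ?_⟩
      rintro rfl
      exact (eq_update_of_agree fun j hj => (h j hj).symm).symm
    simp only [hx, allOnes, pauliX]
    generalize x t = a
    generalize y t = b
    split_ifs <;> fin_cases a <;> fin_cases b <;> simp_all
  · rw [if_neg h, if_neg]
    rintro rfl
    exact h fun j hj => Function.update_of_ne hj _ _

lemma controlledGate_phase (q : ι) (w : ℂ) :
    controlledGate ∅ q !![1, 0; 0, w] = Matrix.diagonal (fun x => if x q = 1 then w else 1) := by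
  ext x y
  simp only [controlledGate, Finset.notMem_empty, false_implies, implies_true, if_true,
    Matrix.diagonal_apply]
  by_cases hxy : x = y
  · subst hxy
    simp only [implies_true, if_true]
    generalize x q = a
    fin_cases a <;> simp
  · rw [if_neg hxy]
    split_ifs with h
    · have : x q ≠ y q := fun hq => hxy <| by
        ext j
        by_cases hj : j = q
        · rw [hj, hq]
        · rw [h j hj]
      revert this
      generalize x q = a
      generalize y q = b
      fin_cases a <;> fin_cases b <;> simp
    · rfl

lemma controlledGate_conj {S : Finset ι} {t : ι} (ht : t ∉ S)
    {A B U : Matrix (Fin 2) (Fin 2) ℂ} (hAB : A * B = 1) :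
    controlledGate ∅ t A * controlledGate S t U * controlledGate ∅ t B =
      controlledGate S t (A * U * B) := by
  simp only [controlledGate_eq_blockGate]
  rw [blockGate_mul (indepOf_controls (Finset.notMem_empty t) _ _) (indepOf_controls ht _ _),
    blockGate_mul _ (indepOf_controls (Finset.notMem_empty t) _ _)]
  · congr 1
    ext1 x
    split_ifs with h h' h' <;> simp_all
  · intro x b
    simp only [controls_update ht, controls_update (Finset.notMem_empty t)]

end PermGates

/-! ### Circuits for NOT, CNOT and Toffoli gates -/

section Classical

variable {ι : Type} [Fintype ι] [DecidableEq ι]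

/-- The reversible map `σ` and its inverse are implemented in depth `D` inside `A`. -/
def PermImplementable (A : Finset ι) (D : ℕ) (σ : Equiv.Perm (ι → Fin 2)) : Prop :=
  Implementable A D (permGate σ) ∧ Implementable A D (permGate σ⁻¹)

namespace PermImplementable

variable {A B : Finset ι} {D D' : ℕ} {σ τ : Equiv.Perm (ι → Fin 2)}

lemma mono (h : PermImplementable A D σ) (hA : A ⊆ B) (hD : D ≤ D') :
    PermImplementable B D' σ :=
  ⟨h.1.mono hA hD, h.2.mono hA hD⟩

lemma one (A : Finset ι) : PermImplementable A 0 (1 : Equiv.Perm (ι → Fin 2)) := by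
  have := Implementable.one A
  rw [← permGate_one] at this
  exact ⟨this, by rwa [inv_one]⟩

lemma inv (h : PermImplementable A D σ) : PermImplementable A D σ⁻¹ :=
  ⟨h.2, by rw [inv_inv]; exact h.1⟩

lemma mul (h : PermImplementable A D σ) (h' : PermImplementable A D' τ) :
    PermImplementable A (D + D') (σ * τ) := by
  refine ⟨by rw [permGate_mul]; exact h.1.mul h'.1, ?_⟩
  rw [mul_inv_rev, permGate_mul, add_comm]
  exact h'.2.mul h.2

lemma parallel (hAB : Disjoint A B) (h : PermImplementable A D σ)
    (h' : PermImplementable B D τ) : PermImplementable (A ∪ B) D (σ * τ) := by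
  refine ⟨by rw [permGate_mul]; exact h.1.parallel hAB h'.1, ?_⟩
  rw [mul_inv_rev, permGate_mul, Finset.union_comm]
  exact h'.2.parallel hAB.symm h.2

lemma of_toggle {S : Finset ι} {t : ι} (h : Implementable A D (permGate (toggle S t))) :
    PermImplementable A D (toggle S t) :=
  ⟨h, by rwa [toggle_inv]⟩

end PermImplementable

lemma permImplementable_not {A : Finset ι} {t : ι} (ht : t ∈ A) :
    PermImplementable A 1 (toggle ∅ t) := by
  apply PermImplementable.of_toggle
  rw [← controlledGate_pauliX (Finset.notMem_empty t)]
  refine implementable_single ht ?_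
  rw [Matrix.mem_unitaryGroup_iff]
  ext i j
  fin_cases i <;> fin_cases j <;> simp [pauliX, Matrix.mul_apply, Matrix.star_apply]

lemma permImplementable_cnot {A : Finset ι} {c t : ι} (hct : c ≠ t) (hc : c ∈ A) (ht : t ∈ A) :
    PermImplementable A 1 (toggle {c} t) := by
  apply PermImplementable.of_toggle
  rw [← controlledGate_pauliX (by simpa using hct.symm)]
  exact implementable_cnot hct hc ht

lemma implementable_phase {A : Finset ι} {q : ι} (hq : q ∈ A) {w : ℂ} (hw : ‖w‖ = 1) :
    Implementable A 1 (Matrix.diagonal (fun x : ι → Fin 2 => if x q = 1 then w else 1)) := by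
  rw [← controlledGate_phase]
  refine implementable_single hq ?_
  rw [Matrix.mem_unitaryGroup_iff]
  have : w * star w = 1 := by
    rw [Complex.star_def, Complex.mul_conj, Complex.normSq_eq_norm_sq, hw]; simp
  ext i j
  fin_cases i <;> fin_cases j <;> simp [Matrix.mul_apply, Matrix.star_apply]
  simpa using this

lemma Implementable.conj_diagonal {A : Finset ι} {D D' : ℕ} {σ : Equiv.Perm (ι → Fin 2)}
    {φ : (ι → Fin 2) → ℂ} (hσ : PermImplementable A D σ)
    (hφ : Implementable A D' (Matrix.diagonal φ)) :
    Implementable A (D + D' + D) (Matrix.diagonal (fun x => φ (σ x))) := by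
  rw [← permGate_conj_diagonal]
  exact (hσ.2.mul hφ).mul hσ.1

lemma Implementable.mul_diagonal {A : Finset ι} {D D' : ℕ} {φ ψ : (ι → Fin 2) → ℂ}
    (hφ : Implementable A D (Matrix.diagonal φ)) (hψ : Implementable A D' (Matrix.diagonal ψ)) :
    Implementable A (D + D') (Matrix.diagonal (fun x => φ x * ψ x)) := by
  rw [← Matrix.diagonal_mul_diagonal]
  exact hφ.mul hψ

/-- A depth bound for the Toffoli gate. -/
abbrev toffoliDepth : ℕ := 19

lemma exists_eighth_root : ∃ w : ℂ, ‖w‖ = 1 ∧ w ^ 4 = -1 := by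
  refine ⟨Complex.exp (((Real.pi / 4 : ℝ) : ℂ) * Complex.I), Complex.norm_exp_ofReal_mul_I _, ?_⟩
  rw [← Complex.exp_nat_mul, ← Complex.exp_pi_mul_I]
  congr 1
  push_cast
  ring

/-- For bits a, b, c, with ⊕ addition mod 2, 4abc = a + b + c - (a⊕b) - (a⊕c) - (b⊕c) + (a⊕b⊕c) over
the integers. With w⁴ = -1, the sign (-1)^(abc) is therefore a product of seven phases w or w⁻¹, at
depth 3·1 + 3·3 + 5 = 17. -/
lemma implementable_ccz {A : Finset ι} {a b c : ι} (hab : a ≠ b) (hac : a ≠ c) (hbc : b ≠ c)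
    (ha : a ∈ A) (hb : b ∈ A) (hc : c ∈ A) :
    Implementable A 17 (Matrix.diagonal
      (fun x : ι → Fin 2 => if x a = 1 ∧ x b = 1 ∧ x c = 1 then -1 else 1)) := by
  obtain ⟨w, hw, hw4⟩ := exists_eighth_root
  have hw' : ‖w⁻¹‖ = 1 := by rw [norm_inv, hw, inv_one]
  have hw0 : w ≠ 0 := by rintro rfl; simp at hw
  have hTa := implementable_phase ha hw
  have hTb := implementable_phase hb hw
  have hTc := implementable_phase hc hw
  have hab' := Implementable.conj_diagonal (permImplementable_cnot hab ha hb)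
    (implementable_phase hb hw')
  have hac' := Implementable.conj_diagonal (permImplementable_cnot hac ha hc)
    (implementable_phase hc hw')
  have hbc' := Implementable.conj_diagonal (permImplementable_cnot hbc hb hc)
    (implementable_phase hc hw')
  have habc := Implementable.conj_diagonal (permImplementable_cnot hac ha hc)
    (Implementable.conj_diagonal (permImplementable_cnot hbc hb hc) (implementable_phase hc hw))
  have := ((((((hTa.mul_diagonal hTb).mul_diagonal hTc).mul_diagonal hab').mul_diagonal
    hac').mul_diagonal hbc').mul_diagonal habc)
  convert this using 3 with x
  rw [toggle_apply_self (by simpa using hab.symm), toggle_apply_self (by simpa using hac.symm),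
    toggle_apply_self (by simpa using hbc.symm), toggle_apply_self (by simpa using hbc.symm),
    toggle_apply_self (by simpa using hac.symm)]
  simp only [allOnes_singleton, toggle_apply_of_ne hbc]
  generalize x a = p
  generalize x b = q
  generalize x c = r
  fin_cases p <;> fin_cases q <;> fin_cases r <;> simp <;> field_simp
  rw [← hw4]

lemma controlledGate_pauliZ (a b t : ι) :
    controlledGate {a, b} t !![1, 0; 0, -1] = Matrix.diagonal
      (fun x : ι → Fin 2 => if x a = 1 ∧ x b = 1 ∧ x t = 1 then -1 else 1) := by
  ext x y
  simp only [controlledGate, Finset.mem_insert, Finset.mem_singleton, forall_eq_or_imp,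
    forall_eq, Matrix.diagonal_apply]
  by_cases hxy : x = y
  · subst hxy
    simp only [implies_true, if_true]
    generalize x t = p
    generalize x a = q
    generalize x b = r
    fin_cases p <;> fin_cases q <;> fin_cases r <;> simp
  · rw [if_neg hxy]
    by_cases h : ∀ j, j ≠ t → x j = y j
    · have : x t ≠ y t := fun hq => hxy <| by
        ext j
        by_cases hj : j = t
        · rw [hj, hq]
        · rw [h j hj]
      rw [if_pos h]
      revert this
      generalize x t = p
      generalize y t = q
      fin_cases p <;> fin_cases q <;> simp
    · rw [if_neg h]

lemma exists_hadamard : ∃ H ∈ Matrix.unitaryGroup (Fin 2) ℂ,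
    H * H = 1 ∧ H * !![1, 0; 0, -1] * H = pauliX := by
  have h2 : ((√2 : ℝ) : ℂ) * ((√2 : ℝ) : ℂ) = 2 := by
    rw [← Complex.ofReal_mul, Real.mul_self_sqrt (by norm_num)]; simp
  have h0 : ((√2 : ℝ) : ℂ) ≠ 0 := by
    intro h; rw [h] at h2; norm_num at h2
  set s : ℂ := ((√2 : ℝ) : ℂ) with hs
  have hss : s⁻¹ * s⁻¹ = 2⁻¹ := by rw [← mul_inv, h2]
  have hst : (starRingEnd ℂ) s = s := Complex.conj_ofReal _
  have hHH : (!![s⁻¹, s⁻¹; s⁻¹, -s⁻¹] : Matrix (Fin 2) (Fin 2) ℂ) * !![s⁻¹, s⁻¹; s⁻¹, -s⁻¹] = 1 := by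
    ext i j
    fin_cases i <;> fin_cases j <;> simp [Matrix.mul_apply, hss] <;> norm_num
  refine ⟨!![s⁻¹, s⁻¹; s⁻¹, -s⁻¹], ?_, hHH, ?_⟩
  · rw [Matrix.mem_unitaryGroup_iff]
    convert hHH using 2
    ext i j
    fin_cases i <;> fin_cases j <;> simp [Matrix.star_apply, hst]
  · ext i j
    fin_cases i <;> fin_cases j <;> simp [Matrix.mul_apply, hss, pauliX] <;> norm_num

/-- Hadamard gates on the target turn the doubly controlled Z into the doubly controlled X, adding
two layers to 17. -/
lemma permImplementable_toffoli {A : Finset ι} {a b t : ι} (hab : a ≠ b) (hat : a ≠ t)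
    (hbt : b ≠ t) (ha : a ∈ A) (hb : b ∈ A) (ht : t ∈ A) :
    PermImplementable A toffoliDepth (toggle {a, b} t) := by
  apply PermImplementable.of_toggle
  obtain ⟨H, hH, hHH, hX⟩ := exists_hadamard
  have htS : t ∉ ({a, b} : Finset ι) := by simp [hat.symm, hbt.symm]
  rw [← controlledGate_pauliX htS, ← hX, ← controlledGate_conj htS hHH,
    controlledGate_pauliZ]
  exact ((implementable_single ht hH).mul (implementable_ccz hab hat hbt ha hb ht)).mul
    (implementable_single ht hH)

lemma permImplementable_toggle_of_card_le_two {A S : Finset ι} {t : ι} (htS : t ∉ S)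
    (hS : S.card ≤ 2) (hSA : S ⊆ A) (ht : t ∈ A) :
    PermImplementable A toffoliDepth (toggle S t) := by
  obtain h | h | h : S.card = 0 ∨ S.card = 1 ∨ S.card = 2 := by omega
  · rw [Finset.card_eq_zero] at h
    subst h
    exact (permImplementable_not ht).mono subset_rfl (by norm_num)
  · obtain ⟨a, rfl⟩ := Finset.card_eq_one.1 h
    simp only [Finset.mem_singleton] at htS
    exact (permImplementable_cnot (Ne.symm htS) (hSA (by simp)) ht).mono subset_rfl (by norm_num)
  · obtain ⟨a, b, hab, rfl⟩ := Finset.card_eq_two.1 h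
    simp only [Finset.mem_insert, Finset.mem_singleton, not_or] at htS
    exact permImplementable_toffoli hab (Ne.symm htS.1) (Ne.symm htS.2) (hSA (by simp))
      (hSA (by simp)) ht

end Classical

/-! ### Multi-controlled NOT gates with dirty or clean ancillas -/

section Toggles

variable {ι : Type} [DecidableEq ι]

lemma allOnes_toggle {S F : Finset ι} {t : ι} (ht : t ∉ S) (x : ι → Fin 2) :
    allOnes S (toggle F t x) = allOnes S x :=
  allOnes_congr fun _ hc => toggle_apply_of_ne (ne_of_mem_of_not_mem hc ht) x

/-- A toggle whose control set is split in two halves, computed with two dirty bits `a`, `b`. -/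
lemma toggle_union_eq {L R : Finset ι} {t a b : ι} (htL : t ∉ L) (htR : t ∉ R) (haL : a ∉ L)
    (haR : a ∉ R) (hbL : b ∉ L) (hbR : b ∉ R) (hab : a ≠ b) (hat : a ≠ t) (hbt : b ≠ t) :
    toggle (L ∪ R) t =
      (toggle R b * (toggle {a, b} t * (toggle L a * toggle {a, b} t))) *
        (toggle R b * (toggle {a, b} t * (toggle L a * toggle {a, b} t))) := by
  have htab : t ∉ ({a, b} : Finset ι) := by simp [hat.symm, hbt.symm]
  have htLR : t ∉ L ∪ R := by simp [htL, htR]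
  ext1 x
  simp only [Equiv.Perm.mul_apply]
  funext q
  by_cases hqt : q = t
  · subst hqt
    simp only [toggle_apply_self htLR, toggle_apply_self htab, toggle_apply_self haL,
      toggle_apply_self hbR, toggle_apply_of_ne hat, toggle_apply_of_ne hat.symm,
      toggle_apply_of_ne hbt, toggle_apply_of_ne hbt.symm, toggle_apply_of_ne hab,
      toggle_apply_of_ne hab.symm, allOnes_toggle htL, allOnes_toggle htR, allOnes_toggle haL,
      allOnes_toggle haR, allOnes_toggle hbL, allOnes_insert,
      allOnes_singleton, allOnes_union]
    -- With u, v the initial values of a, b, the target receives uv + (u+l)v + (u+l)(v+r) + u(v+r) =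
    -- lr over the field with two elements.
    generalize x q = p
    generalize x a = u
    generalize x b = v
    generalize allOnes L x = l
    generalize allOnes R x = r
    revert p u v l r
    decide
  · by_cases hqa : q = a
    · subst hqa
      simp only [toggle_apply_of_ne hqt, toggle_apply_self haL, toggle_apply_of_ne hab,
        allOnes_toggle htL, allOnes_toggle haL, allOnes_toggle hbL, fin_two_add_self_right]
    · by_cases hqb : q = b
      · subst hqb
        simp only [toggle_apply_of_ne hqt, toggle_apply_self hbR, toggle_apply_of_ne hab.symm,
          allOnes_toggle htR, allOnes_toggle haR, allOnes_toggle hbR, fin_two_add_self_right]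
      · simp only [toggle_apply_of_ne hqt, toggle_apply_of_ne hqa, toggle_apply_of_ne hqb]

lemma perm_apply_inv {α : Type*} (σ : Equiv.Perm α) (x : α) : σ (σ⁻¹ x) = x :=
  σ.apply_symm_apply x

/-- `σ` changes only bits in `C`. -/
def FixesOff (C : Finset ι) (σ : Equiv.Perm (ι → Fin 2)) : Prop :=
  ∀ x, ∀ q ∉ C, σ x q = x q

/-- `σ` neither reads nor changes the bit `q`. -/
def Ignores (σ : Equiv.Perm (ι → Fin 2)) (q : ι) : Prop :=
  ∀ x b, σ (Function.update x q b) = Function.update (σ x) q b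

omit [DecidableEq ι] in
lemma FixesOff.mul {C : Finset ι} {σ τ : Equiv.Perm (ι → Fin 2)} (hσ : FixesOff C σ)
    (hτ : FixesOff C τ) : FixesOff C (σ * τ) := fun x q hq => by
  rw [Equiv.Perm.mul_apply, hσ _ q hq, hτ _ q hq]

omit [DecidableEq ι] in
lemma FixesOff.inv {C : Finset ι} {σ : Equiv.Perm (ι → Fin 2)} (hσ : FixesOff C σ) :
    FixesOff C σ⁻¹ := fun x q hq => by
  have := hσ (σ⁻¹ x) q hq
  rw [perm_apply_inv] at this
  exact this.symm

omit [DecidableEq ι] in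
lemma FixesOff.mono {C C' : Finset ι} {σ : Equiv.Perm (ι → Fin 2)} (hσ : FixesOff C σ)
    (h : C ⊆ C') : FixesOff C' σ := fun x q hq => hσ x q fun hq' => hq (h hq')

lemma Ignores.mul {q : ι} {σ τ : Equiv.Perm (ι → Fin 2)} (hσ : Ignores σ q) (hτ : Ignores τ q) :
    Ignores (σ * τ) q := fun x b => by
  rw [Equiv.Perm.mul_apply, hτ, hσ, Equiv.Perm.mul_apply]

lemma Ignores.inv {q : ι} {σ : Equiv.Perm (ι → Fin 2)} (hσ : Ignores σ q) :
    Ignores σ⁻¹ q := fun x b => by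
  rw [Equiv.Perm.inv_eq_iff_eq, hσ, perm_apply_inv]

lemma fixesOff_toggle (S : Finset ι) (t : ι) : FixesOff {t} (toggle S t) :=
  fun x _ hq => toggle_apply_of_ne (by simpa using hq) x

lemma ignores_toggle {S : Finset ι} {t q : ι} (htS : t ∉ S) (hqS : q ∉ S) (hqt : q ≠ t) :
    Ignores (toggle S t) q := fun x b => by
  rw [toggle_apply htS, toggle_apply htS, allOnes_update hqS, Function.update_of_ne hqt.symm,
    Function.update_comm hqt]

variable [Fintype ι]

/-- A NOT gate with at most `2 ^ s` controls, using two dirty bits. -/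
lemma permImplementable_toggle_dirty (s : ℕ) {F : Finset ι} {t a b : ι} (hF : F.card ≤ 2 ^ s)
    (ht : t ∉ F) (ha : a ∉ F) (hb : b ∉ F) (hab : a ≠ b) (hat : a ≠ t) (hbt : b ≠ t) :
    PermImplementable Finset.univ (45 * 4 ^ s - 26) (toggle F t) := by
  induction s generalizing F t a b with
  | zero =>
    exact (permImplementable_toggle_of_card_le_two ht (by omega) (Finset.subset_univ _)
      (Finset.mem_univ _)).mono subset_rfl (by norm_num)
  | succ s ih =>
    obtain ⟨L, hLF, hL⟩ := Finset.exists_subset_card_eq (min_le_right (2 ^ s) F.card)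
    have hR : (F \ L).card ≤ 2 ^ s := by
      rw [Finset.card_sdiff_of_subset hLF, hL]
      rw [pow_succ] at hF
      omega
    have hLs : L.card ≤ 2 ^ s := hL ▸ min_le_left _ _
    have hsub : F \ L ⊆ F := Finset.sdiff_subset
    -- The two halves need no fresh dirty bits: t and the other one of a, b serve.
    have h1 := ih hLs (fun h => ha (hLF h)) (fun h => hb (hLF h)) (fun h => ht (hLF h)) hbt
      hab.symm hat.symm
    have h2 := ih hR (fun h => hb (hsub h)) (fun h => ha (hsub h)) (fun h => ht (hsub h)) hat
      hab hbt.symm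
    have h3 : PermImplementable Finset.univ toffoliDepth (toggle {a, b} t) :=
      permImplementable_toffoli hab hat hbt (Finset.mem_univ _) (Finset.mem_univ _)
        (Finset.mem_univ _)
    rw [← Finset.union_sdiff_of_subset hLF, toggle_union_eq (fun h => ht (hLF h))
      (fun h => ht (hsub h)) (fun h => ha (hLF h)) (fun h => ha (hsub h)) (fun h => hb (hLF h))
      (fun h => hb (hsub h)) hab hat hbt]
    have h4 := h2.mul (h3.mul (h1.mul h3))
    refine (h4.mul h4).mono subset_rfl ?_
    -- The recurrence is D(s+1) = 4 D(s) + 4·19 with D(0) = 19. In a bound k·4^s - c it requires 3c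
    -- ≥ 76, whence c = 26 and k = 19 + 26.
    have : 1 ≤ 4 ^ s := Nat.one_le_pow _ _ (by norm_num)
    simp only [toffoliDepth]
    rw [pow_succ]
    omega

/-- One layer of Toffoli gates writing the conjunctions of pairs of bits of `R` into the clean
bits `C`. -/
lemma exists_pairing (p : ℕ) {R C : Finset ι} (hR : R.card = 2 * p) (hC : C.card = p)
    (hRC : Disjoint R C) :
    ∃ ρ : Equiv.Perm (ι → Fin 2), PermImplementable (R ∪ C) toffoliDepth ρ ∧ FixesOff C ρ ∧
      (∀ q ∉ R ∪ C, Ignores ρ q) ∧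
      ∀ x, (∀ c ∈ C, x c = 0) → allOnes C (ρ x) = allOnes R x := by
  induction p generalizing R C with
  | zero =>
    simp only [mul_zero, Finset.card_eq_zero] at hR hC
    subst hR hC
    exact ⟨1, (PermImplementable.one _).mono subset_rfl (by norm_num), fun _ _ _ => rfl,
      fun _ _ _ _ => rfl, fun _ _ => rfl⟩
  | succ p ih =>
    obtain ⟨P, hPR, hP⟩ := Finset.exists_subset_card_eq (show 2 ≤ R.card by omega)
    obtain ⟨a, b, hab, rfl⟩ := Finset.card_eq_two.1 hP
    obtain ⟨c, hc⟩ := Finset.card_pos.1 (show 0 < C.card by omega)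
    have ha : a ∈ R := hPR (by simp)
    have hb : b ∈ R := hPR (by simp)
    have hnot : ∀ {q}, q ∈ R → q ∉ C := fun h h' => Finset.disjoint_left.1 hRC h h'
    have hcR : c ∉ R := fun h => hnot h hc
    have hac : a ≠ c := fun h => hnot ha (h ▸ hc)
    have hbc : b ≠ c := fun h => hnot hb (h ▸ hc)
    have hcab : c ∉ ({a, b} : Finset ι) := by simp [hac.symm, hbc.symm]
    obtain ⟨ρ, hρ, hfix, hign, hval⟩ := ih (R := R \ {a, b}) (C := C.erase c)
      (by rw [Finset.card_sdiff_of_subset hPR, hR, hP]; omega)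
      (by rw [Finset.card_erase_of_mem hc, hC]; omega)
      (Finset.disjoint_of_subset_left Finset.sdiff_subset
        (Finset.disjoint_of_subset_right (Finset.erase_subset _ _) hRC))
    have hdisj : Disjoint ((R \ {a, b}) ∪ C.erase c) (insert c ({a, b} : Finset ι)) := by
      rw [Finset.disjoint_left]
      intro q hq hq'
      simp only [Finset.mem_union, Finset.mem_sdiff, Finset.mem_erase, Finset.mem_insert,
        Finset.mem_singleton] at hq hq'
      rcases hq' with rfl | rfl | rfl
      · rcases hq with hq | hq
        · exact hnot hq.1 hc
        · exact hq.1 rfl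
      · rcases hq with hq | hq
        · exact hq.2 (Or.inl rfl)
        · exact hnot ha hq.2
      · rcases hq with hq | hq
        · exact hq.2 (Or.inr rfl)
        · exact hnot hb hq.2
    have hunion : (R \ {a, b}) ∪ C.erase c ∪ insert c ({a, b} : Finset ι) ⊆ R ∪ C := by
      intro q hq
      simp only [Finset.mem_union, Finset.mem_sdiff, Finset.mem_erase, Finset.mem_insert,
        Finset.mem_singleton] at hq ⊢
      rcases hq with (hq | hq) | rfl | rfl | rfl <;> tauto
    have htof : PermImplementable (insert c ({a, b} : Finset ι)) toffoliDepth
        (toggle {a, b} c) :=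
      permImplementable_toffoli hab hac hbc (by simp) (by simp) (by simp)
    have hcign : Ignores ρ c := hign c (by simp [hcR])
    refine ⟨ρ * toggle {a, b} c, (hρ.parallel hdisj htof).mono hunion le_rfl, ?_, ?_, ?_⟩
    · exact (hfix.mono (Finset.erase_subset _ _)).mul
        ((fixesOff_toggle _ _).mono (by simpa using hc))
    · intro q hq
      simp only [Finset.mem_union, not_or] at hq
      refine (hign q ?_).mul (ignores_toggle hcab ?_ ?_)
      · simp [hq.1, hq.2]
      · exact fun h => hq.1 (hPR h)
      · exact (ne_of_mem_of_not_mem hc hq.2).symm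
    · intro x hx
      have hout : allOnes (C.erase c) (ρ (toggle {a, b} c x)) = allOnes (R \ {a, b}) x := by
        rw [hval, allOnes_toggle]
        · simp [hcR]
        · intro q hq
          rw [Finset.mem_erase] at hq
          rw [toggle_apply_of_ne hq.1, hx q hq.2]
      have hcv : ρ (toggle {a, b} c x) c = allOnes {a, b} x := by
        rw [hfix _ c (by simp), toggle_apply_self hcab, hx c hc, zero_add]
      rw [Equiv.Perm.mul_apply]
      conv_lhs => rw [← Finset.insert_erase hc]
      conv_rhs => rw [← Finset.union_sdiff_of_subset hPR]
      rw [allOnes_insert, allOnes_union, hout, hcv]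

/-- A NOT gate with at most `2 ^ s` controls, in depth linear in `s`, using clean bits `C`. -/
lemma exists_clean_toggle (s : ℕ) {R C : Finset ι} {z : ι} (hR : R.card ≤ 2 ^ s)
    (hRC : R.card ≤ C.card) (hdisj : Disjoint R C) (hzR : z ∉ R) (hzC : z ∉ C) :
    ∃ τ : Equiv.Perm (ι → Fin 2), PermImplementable Finset.univ (38 * s + 19) τ ∧
      FixesOff (insert z C) τ ∧ (∀ q ∉ insert z (R ∪ C), Ignores τ q) ∧
      ∀ x, (∀ c ∈ C, x c = 0) → τ x = toggle R z x := by
  induction s generalizing R C with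
  | zero =>
    refine ⟨toggle R z, (permImplementable_toggle_of_card_le_two hzR (by omega)
      (Finset.subset_univ _) (Finset.mem_univ _)).mono subset_rfl (by norm_num),
      (fixesOff_toggle _ _).mono (by simp), ?_, fun _ _ => rfl⟩
    intro q hq
    simp only [Finset.mem_insert, Finset.mem_union, not_or] at hq
    exact ignores_toggle hzR hq.2.1 hq.1
  | succ s ih =>
    rw [pow_succ] at hR
    -- P is the part of R that is paired up, K receives the conjunctions of the pairs, and a
    -- possible odd bit R \ P passes to the next level unchanged.
    obtain ⟨P, hPR, hP⟩ := Finset.exists_subset_card_eq (show 2 * (R.card / 2) ≤ R.card by omega)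
    obtain ⟨K, hKC, hK⟩ := Finset.exists_subset_card_eq (show R.card / 2 ≤ C.card by omega)
    rw [Finset.disjoint_left] at hdisj
    have hcl : (R \ P).card = R.card - 2 * (R.card / 2) := by
      rw [Finset.card_sdiff_of_subset hPR, hP]
    have hKL : Disjoint K (R \ P) := by
      rw [Finset.disjoint_left]
      intro q hq hq'
      exact hdisj (Finset.mem_sdiff.1 hq').1 (hKC hq)
    have hcard : (K ∪ R \ P).card = R.card / 2 + (R.card - 2 * (R.card / 2)) := by
      rw [Finset.card_union_of_disjoint hKL, hK, hcl]
    obtain ⟨ρ, hρ, hρfix, hρign, hρval⟩ := exists_pairing (R.card / 2) hP hK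
      (Finset.disjoint_left.2 fun q hq hq' => hdisj (hPR hq) (hKC hq'))
    obtain ⟨τ, hτ, hτfix, hτign, hτval⟩ := ih (R := K ∪ R \ P) (C := C \ K)
      (by omega) (by rw [Finset.card_sdiff_of_subset hKC, hK]; omega)
      (by
        rw [Finset.disjoint_left]
        intro q hq hq'
        simp only [Finset.mem_union, Finset.mem_sdiff] at hq hq'
        rcases hq with hq | hq
        · exact hq'.2 hq
        · exact hdisj hq.1 hq'.1)
      (by simp only [Finset.mem_union, Finset.mem_sdiff]; exact fun h =>
        h.elim (fun h => hzC (hKC h)) (fun h => hzR h.1))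
      (by simp only [Finset.mem_sdiff]; exact fun h => hzC h.1)
    have hρ' := hρ.mono (Finset.subset_univ _) le_rfl
    have hzρ : Ignores ρ z := hρign z (by
      simp only [Finset.mem_union]; exact fun h => h.elim (fun h => hzR (hPR h))
        (fun h => hzC (hKC h)))
    have hKins : K ⊆ insert z C := hKC.trans (Finset.subset_insert _ _)
    -- The final ρ⁻¹ uncomputes K; each level thus costs two Toffoli layers, 38 in depth.
    refine ⟨ρ⁻¹ * (τ * ρ), (hρ'.inv.mul (hτ.mul hρ')).mono subset_rfl ?_, ?_, ?_, ?_⟩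
    · simp only [toffoliDepth]; omega
    · exact (hρfix.inv.mono hKins).mul ((hτfix.mono
        (Finset.insert_subset_insert _ Finset.sdiff_subset)).mul (hρfix.mono hKins))
    · intro q hq
      simp only [Finset.mem_insert, Finset.mem_union, not_or] at hq
      have h1 : Ignores ρ q := hρign q (by
        simp only [Finset.mem_union]; exact fun h => h.elim (fun h => hq.2.1 (hPR h))
          (fun h => hq.2.2 (hKC h)))
      refine h1.inv.mul ((hτign q ?_).mul h1)
      simp only [Finset.mem_insert, Finset.mem_union, Finset.mem_sdiff]
      rintro (h | (h | h) | h)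
      · exact hq.1 h
      · exact hq.2.2 (hKC h)
      · exact hq.2.1 h.1
      · exact hq.2.2 h.1
    · intro x hx
      have hzKL : z ∉ K ∪ R \ P := by
        simp only [Finset.mem_union, Finset.mem_sdiff]
        exact fun h => h.elim (fun h => hzC (hKC h)) (fun h => hzR h.1)
      have hz : ρ x z = x z := hρfix x z fun h => hzC (hKC h)
      have hL : allOnes (R \ P) (ρ x) = allOnes (R \ P) x :=
        allOnes_congr fun q hq => hρfix x q fun h => hdisj (Finset.mem_sdiff.1 hq).1 (hKC h)
      have hall : allOnes (K ∪ R \ P) (ρ x) = allOnes R x := by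
        conv_rhs => rw [← Finset.union_sdiff_of_subset hPR]
        rw [allOnes_union, allOnes_union, hL, hρval x fun c hc => hx c (hKC hc)]
      rw [Equiv.Perm.mul_apply, Equiv.Perm.mul_apply, Equiv.Perm.inv_eq_iff_eq, hτval,
        toggle_apply hzKL, toggle_apply hzR, hzρ, hz, hall]
      intro c hc
      rw [Finset.mem_sdiff] at hc
      rw [hρfix x c hc.2, hx c hc.1]

/-- A layer of NOT gates. -/
lemma exists_negation (B : Finset ι) :
    ∃ ν : Equiv.Perm (ι → Fin 2), PermImplementable B 1 ν ∧
      ∀ x q, ν x q = if q ∈ B then x q + 1 else x q := by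
  induction B using Finset.induction_on with
  | empty => exact ⟨1, (PermImplementable.one _).mono subset_rfl (by norm_num), by simp⟩
  | insert a B ha ih =>
    obtain ⟨ν, hν, hval⟩ := ih
    refine ⟨toggle ∅ a * ν, ?_, ?_⟩
    · rw [Finset.insert_eq]
      exact (permImplementable_not (Finset.mem_singleton_self a)).parallel
        (by simpa using ha) hν
    · intro x q
      rw [Equiv.Perm.mul_apply]
      by_cases hq : q = a
      · subst hq
        simp [toggle_apply_self, hval, ha, allOnes_empty]
      · rw [toggle_apply_of_ne hq, hval]
        simp [hq]

end Toggles

/-! ### Logarithmically many stages of conditionally clean bits -/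

section ConditionallyClean

variable {ι : Type} [Fintype ι] [DecidableEq ι]

/-- The base case of `exists_conditional_toggle`: the bits of `C` serve as dirty bits. -/
lemma exists_conditional_toggle_empty {n s J : ℕ} {F C R : Finset ι} {t : ι} (hR : R = ∅)
    (htF : t ∉ F) (htC : t ∉ C) (hFC : ∀ ⦃q⦄, q ∈ F → q ∉ C) (hC3 : 3 ≤ C.card)
    (hF : F.card + n ≤ 2 ^ s) :
    ∃ (τ : Equiv.Perm (ι → Fin 2)) (g : (ι → Fin 2) → Fin 2),
      PermImplementable Finset.univ (n * (76 * J + 40) + 45 * 4 ^ s) τ ∧ IndepOf t g ∧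
      (∀ x, τ x = xorAt t g x) ∧
      ∀ x, ((∀ f ∈ F, x f = 1) → ∀ c ∈ C, x c = 0) → g x = allOnes (F ∪ R) x := by
  subst hR
  obtain ⟨P, hPC, hP⟩ := Finset.exists_subset_card_eq (show 2 ≤ C.card by omega)
  obtain ⟨a, b, hab, rfl⟩ := Finset.card_eq_two.1 hP
  have ha : a ∈ C := hPC (by simp)
  have hb : b ∈ C := hPC (by simp)
  refine ⟨toggle F t, allOnes F, ?_, fun x b => allOnes_update htF x b, toggle_apply htF,
    fun x _ => by rw [Finset.union_empty]⟩
  exact (permImplementable_toggle_dirty s (by omega) htF (fun h => hFC h ha)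
    (fun h => hFC h hb) hab (ne_of_mem_of_not_mem ha htC)
    (ne_of_mem_of_not_mem hb htC)).mono subset_rfl (by omega)

/-- A NOT gate with controls `F ∪ R`, correct on the inputs for which the bits `C` are clean as
soon as all bits of `F` are set.  On all inputs it is a toggle of the bit `t`. -/
lemma exists_conditional_toggle (n i s J : ℕ) (hJ : i + n = J) {F C R : Finset ι} {t : ι}
    (htF : t ∉ F) (htC : t ∉ C) (htR : t ∉ R) (hFC : Disjoint F C) (hFR : Disjoint F R)
    (hCR : Disjoint C R) (hR : R.card + 2 ^ i ≤ 2 ^ J) (hC : R = ∅ ∨ 2 ^ i + 2 ≤ C.card)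
    (hC3 : 3 ≤ C.card) (hF : F.card + n ≤ 2 ^ s) :
    ∃ (τ : Equiv.Perm (ι → Fin 2)) (g : (ι → Fin 2) → Fin 2),
      PermImplementable Finset.univ (n * (76 * J + 40) + 45 * 4 ^ s) τ ∧ IndepOf t g ∧
      (∀ x, τ x = xorAt t g x) ∧
      ∀ x, ((∀ f ∈ F, x f = 1) → ∀ c ∈ C, x c = 0) → g x = allOnes (F ∪ R) x := by
  rw [Finset.disjoint_left] at hFC hFR hCR
  induction n generalizing i F C R with
  | zero =>
    refine exists_conditional_toggle_empty (Finset.card_eq_zero.1 ?_) htF htC hFC hC3 hF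
    rw [← hJ, add_zero] at hR
    omega
  | succ n ih =>
    by_cases hR0 : R = ∅
    · exact exists_conditional_toggle_empty hR0 htF htC hFC hC3 hF
    have hCi : 2 ^ i + 2 ≤ C.card := hC.resolve_left hR0
    obtain ⟨z, hz⟩ := Finset.card_pos.1 (show 0 < C.card by omega)
    have hCe : (C.erase z).card = C.card - 1 := Finset.card_erase_of_mem hz
    have hRpos : 0 < R.card := Finset.card_pos.2 (Finset.nonempty_iff_ne_empty.2 hR0)
    -- One bit z of C becomes the new flag; the at least 2^i + 1 others are the clean ancillas for a
    -- block P of up to 2^i + 1 controls.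
    obtain ⟨P, hPR, hP⟩ := Finset.exists_subset_card_eq (min_le_right (2 ^ i + 1) R.card)
    have hi1 : 1 ≤ 2 ^ i := Nat.one_le_pow _ _ (by norm_num)
    have hP1 : P.card ≤ 2 ^ (i + 1) := by rw [pow_succ]; omega
    have hzR : z ∉ R := hCR hz
    have hzP : z ∉ P := fun h => hzR (hPR h)
    have hzF : z ∉ F := fun h => hFC h hz
    have htz : t ≠ z := fun h => htC (h ▸ hz)
    have htP : t ∉ P := fun h => htR (hPR h)
    have hCP : ∀ {q}, q ∈ C → q ∉ P := fun h h' => hCR h (hPR h')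
    obtain ⟨α, hα, hαfix, hαign, hαval⟩ := exists_clean_toggle (i + 1) (R := P)
      (C := C.erase z) (z := z) hP1 (by omega)
      (Finset.disjoint_left.2 fun q hq hq' => hCP (Finset.mem_of_mem_erase hq') hq) hzP (by simp)
    rw [Finset.insert_erase hz] at hαfix
    obtain ⟨ν, hν, hνval⟩ := exists_negation P
    replace hν := hν.mono (Finset.subset_univ _) le_rfl
    have hcardC : ((C.erase z) ∪ P).card = C.card - 1 + P.card := by
      rw [Finset.card_union_of_disjoint, hCe]
      exact Finset.disjoint_left.2 fun q hq hq' => hCP (Finset.mem_of_mem_erase hq) hq'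
    have hcardR : (R \ P).card = R.card - P.card := Finset.card_sdiff_of_subset hPR
    have hpow : 2 ^ (i + 1) = 2 * 2 ^ i := by rw [pow_succ]; ring
    -- After a full block, the clean bits number at least (2^i + 1) + (2^i + 1) = 2^(i+1) + 2, which
    -- is the invariant for i + 1. If R is used up earlier, only the bound 3 on the size of C is
    -- kept, for the dirty bits of the base case.
    obtain ⟨β, g, hβ, hgind, hβval, hgval⟩ := ih (i + 1) (by omega) (F := insert z F)
      (C := (C.erase z) ∪ P) (R := R \ P)
      (by simp [htz, htF]) (by simp [htC, htP]) (by simp [htR])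
      (by
        intro q hq hq'
        simp only [Finset.mem_insert, Finset.mem_union, Finset.mem_erase] at hq hq'
        rcases hq with rfl | hq
        · rcases hq' with h | h
          · exact h.1 rfl
          · exact hzP h
        · rcases hq' with h | h
          · exact hFC hq h.2
          · exact hFR hq (hPR h))
      (by
        intro q hq hq'
        simp only [Finset.mem_insert, Finset.mem_sdiff] at hq hq'
        rcases hq with rfl | hq
        · exact hzR hq'.1
        · exact hFR hq hq'.1)
      (by
        intro q hq hq'
        simp only [Finset.mem_union, Finset.mem_erase, Finset.mem_sdiff] at hq hq'
        rcases hq with hq | hq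
        · exact hCR hq.2 hq'.1
        · exact hq'.2 hq)
      (by
        by_cases h : R.card ≤ 2 ^ i + 1
        · have : (R \ P).card = 0 := by rw [hcardR, hP]; omega
          rw [this, ← hJ, show i + (n + 1) = (i + 1) + n by ring, pow_add _ (i + 1) n]
          have : 1 ≤ 2 ^ n := Nat.one_le_pow _ _ (by norm_num)
          rw [zero_add]
          exact Nat.le_mul_of_pos_right _ this
        · rw [hcardR, hP, hpow]; omega)
      (by
        by_cases h : R.card ≤ 2 ^ i + 1
        · left
          rw [← Finset.card_eq_zero, hcardR, hP]; omega
        · right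
          rw [hcardC, hP, hpow]; omega)
      (by rw [hcardC, hP]; omega)
      (by rw [Finset.card_insert_of_notMem hzF]; omega)
    have hνt : Ignores ν t := by
      intro x b
      funext q
      by_cases hq : q = t
      · subst hq; simp [hνval, htP]
      · simp [hνval, hq]
    have hαt : Ignores α t := hαign t (by simp [htz, htP, htC])
    have hνν : ∀ x, ν (ν x) = x := by
      intro x
      funext q
      rw [hνval, hνval]
      split_ifs
      · exact fin_two_add_self_right _ _
      · rfl
    have hxt : ∀ x, ν (α x) t = x t := fun x => by
      rw [hνval, if_neg htP, hαfix x t htC]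
    -- Since α and ν ignore t and β changes only t, the conjugate is a toggle of t even on inputs
    -- where C is not clean.
    refine ⟨α⁻¹ * (ν * (β * (ν * α))), fun x => g (ν (α x)), ?_, ?_, ?_, ?_⟩
    · refine (hα.inv.mul (hν.mul (hβ.mul (hν.mul hα)))).mono subset_rfl ?_
      have h1 : 38 * (i + 1) ≤ 38 * J := by omega
      have h2 : (n + 1) * (76 * J + 40) = n * (76 * J + 40) + (76 * J + 40) := by ring
      omega
    · intro x b
      simp only [hαt x b, hνt (α x) b, hgind (ν (α x)) b]
    · intro x
      simp only [Equiv.Perm.mul_apply]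
      rw [Equiv.Perm.inv_eq_iff_eq, hβval, xorAt, xorAt, hαt, hνt, hνν, hxt]
    · intro x hx
      have hyF : ∀ q, q ∉ P → q ∉ C → ν (α x) q = x q := fun q hqP hqC => by
        rw [hνval, if_neg hqP, hαfix x q hqC]
      have hFy : allOnes F (ν (α x)) = allOnes F x :=
        allOnes_congr fun q hq => hyF q (fun h => hFR hq (hPR h)) (hFC hq)
      have hRy : allOnes (R \ P) (ν (α x)) = allOnes (R \ P) x :=
        allOnes_congr fun q hq => hyF q (Finset.mem_sdiff.1 hq).2
          (fun h => hCR h (Finset.mem_sdiff.1 hq).1)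
      have hRx : allOnes R x = allOnes P x * allOnes (R \ P) x := by
        rw [← allOnes_union, Finset.union_sdiff_of_subset hPR]
      by_cases hFx : ∀ f ∈ F, x f = 1
      · have hclean := hx hFx
        have hαx : α x = toggle P z x := hαval x fun c hc => hclean c (Finset.mem_of_mem_erase hc)
        have hyz : ν (α x) z = allOnes P x := by
          rw [hνval, if_neg hzP, hαx, toggle_apply_self hzP, hclean z hz, zero_add]
        change g (ν (α x)) = _
        rw [hgval, allOnes_union, allOnes_insert, hyz, hFy, hRy, allOnes_union, hRx]
        · generalize allOnes F x = u
          generalize allOnes (R \ P) x = v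
          generalize allOnes P x = w
          revert u v w
          decide
        -- If the new flag z is 1, then P was all ones, so its negation is zero; the rest of C is
        -- restored by the clean toggle.
        · intro h c hc
          have hone := h z (Finset.mem_insert_self _ _)
          rw [hyz, allOnes_eq_one] at hone
          rw [hνval, hαx]
          rcases Finset.mem_union.1 hc with hc | hc
          · rw [Finset.mem_erase] at hc
            rw [if_neg (hCP hc.2), toggle_apply_of_ne hc.1, hclean c hc.2]
          · rw [if_pos hc, toggle_apply_of_ne (ne_of_mem_of_not_mem hc hzP), hone c hc]
            rfl
      -- If some old flag is 0, both sides vanish and the cleanness condition for β is vacuous.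
      · change g (ν (α x)) = _
        rw [hgval, allOnes_union, allOnes_insert, hFy, allOnes_union, allOnes_eq_zero hFx]
        · rw [mul_zero, zero_mul, zero_mul]
        · intro h
          refine absurd (fun f hf => ?_) hFx
          rw [← hyF f (fun h => hFR hf (hPR h)) (hFC hf)]
          exact h f (Finset.mem_insert_of_mem hf)

/-- A NOT gate with many controls, using two dirty bits. -/
lemma permImplementable_toggle (J s : ℕ) {S : Finset ι} {t d e : ι} (hS3 : 3 ≤ S.card)
    (hS : S.card ≤ 2 ^ J) (hs : J + 1 ≤ 2 ^ s) (ht : t ∉ S) (hd : d ∉ S) (he : e ∉ S)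
    (hde : d ≠ e) (hdt : d ≠ t) (het : e ≠ t) :
    PermImplementable Finset.univ (2 * (J * (76 * J + 40) + 45 * 4 ^ s) + 1444) (toggle S t) := by
  obtain ⟨A, hAS, hA⟩ := Finset.exists_subset_card_eq hS3
  have hcardR : (S \ A).card = S.card - 3 := by rw [Finset.card_sdiff_of_subset hAS, hA]
  have htA : t ∉ A := fun h => ht (hAS h)
  have hdA : d ∉ A := fun h => hd (hAS h)
  have heA : e ∉ A := fun h => he (hAS h)
  -- Start at i = 0, where the three bits of A meet the bound 2^0 + 2. The J stages create at most J
  -- flags in addition to d, whence J + 1 ≤ 2^s.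
  obtain ⟨τ, g, hτ, hgind, hτval, hgval⟩ := exists_conditional_toggle J 0 s J (zero_add J)
    (F := {d}) (C := A) (R := S \ A) (t := t) (by simpa using hdt.symm) htA (by simp [ht])
    (by simpa using hdA) (by simp [hd]) Finset.disjoint_sdiff
    (by rw [hcardR, pow_zero]; omega) (Or.inr (by rw [hA]; norm_num)) hA.ge
    (by rw [Finset.card_singleton]; omega)
  obtain ⟨ν, hν, hνval⟩ := exists_negation A
  replace hν := hν.mono (Finset.subset_univ _) le_rfl
  have hdirty : PermImplementable Finset.univ (45 * 4 ^ 2 - 26) (toggle A d) :=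
    permImplementable_toggle_dirty 2 (by rw [hA]; norm_num) hdA htA heA het.symm hdt.symm hde.symm
  have hνt : Ignores ν t := by
    intro x b
    funext q
    by_cases hq : q = t
    · subst hq; simp [hνval, htA]
    · simp [hνval, hq]
  have hνν : ∀ x, ν (ν x) = x := by
    intro x
    funext q
    rw [hνval, hνval]
    split_ifs
    · exact fin_two_add_self_right _ _
    · rfl
  have hVind : IndepOf t fun x => g (ν x) := fun x b => by
    simp only [hνt x b, hgind (ν x) b]
  have hV : ∀ x, (ν * (τ * ν)) x = xorAt t (fun x => g (ν x)) x := by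
    intro x
    simp only [Equiv.Perm.mul_apply]
    rw [hτval, xorAt, xorAt, hνt, hνν, hνval x t, if_neg htA]
  have hgA : ∀ x, (∀ q ∈ A, x q = 1) → g (ν x) = x d * allOnes (S \ A) x := by
    intro x hx
    rw [hgval, allOnes_union, allOnes_singleton, hνval, if_neg hdA]
    · congr 1
      exact allOnes_congr fun q hq => by rw [hνval, if_neg (Finset.mem_sdiff.1 hq).2]
    · intro _ c hc
      rw [hνval, if_pos hc, hx c hc]
      rfl
  -- If A is all ones, the two passes add d·r and (d+1)·r to t, where r is the conjunction of S \ A;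
  -- the sum is r, and d is flipped back. Otherwise d is not flipped and the two passes cancel,
  -- because each is a toggle of t on every input.
  have heq : toggle S t =
      (toggle A d * (ν * (τ * ν))) * (toggle A d * (ν * (τ * ν))) := by
    ext1 x
    rw [Equiv.Perm.mul_apply, Equiv.Perm.mul_apply, Equiv.Perm.mul_apply _ (ν * (τ * ν)), hV, hV]
    have hSx : allOnes S x = allOnes A x * allOnes (S \ A) x := by
      rw [← allOnes_union, Finset.union_sdiff_of_subset hAS]
    have hAflip : ∀ (h : (ι → Fin 2) → Fin 2) y, allOnes A (xorAt t h y) = allOnes A y :=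
      fun h y => allOnes_update htA y _
    rw [toggle_apply ht, hSx]
    by_cases hAx : ∀ q ∈ A, x q = 1
    · have h1 : allOnes A x = 1 := allOnes_eq_one.2 hAx
      set y := toggle A d (xorAt t (fun x => g (ν x)) x) with hy
      have hyA : ∀ q ∈ A, y q = 1 := by
        rw [← allOnes_eq_one, hy, allOnes_toggle hdA, hAflip, h1]
      have hyd : y d = x d + 1 := by
        rw [hy, toggle_apply_self hdA, hAflip, h1, xorAt, Function.update_of_ne hdt]
      have hyt : y t = x t + g (ν x) := by
        rw [hy, toggle_apply_of_ne hdt.symm, xorAt, Function.update_self]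
      have hyR : allOnes (S \ A) y = allOnes (S \ A) x := by
        rw [hy, allOnes_toggle (by simp [hd])]
        exact allOnes_update (by simp [ht]) x _
      funext q
      by_cases hqt : q = t
      · subst hqt
        rw [Function.update_self, toggle_apply_of_ne hdt.symm, xorAt, Function.update_self, hyt,
          hgA y hyA, hgA x hAx, hyd, hyR, h1]
        generalize x q = a
        generalize x d = b
        generalize allOnes (S \ A) x = c
        revert a b c
        decide
      · rw [Function.update_of_ne hqt]
        by_cases hqd : q = d
        · subst hqd
          rw [toggle_apply_self hdA, hAflip, allOnes_eq_one.2 hyA, xorAt,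
            Function.update_of_ne hqt, hyd, fin_two_add_self_right]
        · rw [toggle_apply_of_ne hqd, xorAt, Function.update_of_ne hqt, hy,
            toggle_apply_of_ne hqd, xorAt, Function.update_of_ne hqt]
    · have h0 : allOnes A x = 0 := allOnes_eq_zero hAx
      have hfix : ∀ y, allOnes A y = 0 → toggle A d y = y := fun y h => by
        rw [toggle_apply hdA, h, add_zero, Function.update_eq_self]
      rw [hfix (xorAt t _ x) (by rw [hAflip, h0]), xorAt_involutive hVind, hfix x h0, h0,
        zero_mul, add_zero, Function.update_eq_self]
  rw [heq]
  have h1 := hdirty.mul (hν.mul (hτ.mul hν))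
  exact (h1.mul h1).mono subset_rfl (by omega)

end ConditionallyClean

/-! ### Elements of SU(2) as squares of products of two reflections -/

section SpecialUnitary

/-- Determinant 1 gives W* = adj W = tr W - W. Hence W is a scalar plus a multiple of the Hermitian
matrix i(W - W*), and the spectral theorem for the latter diagonalizes W. -/
lemma diagonalize_specialUnitary {W : Matrix (Fin 2) (Fin 2) ℂ}
    (hW : W ∈ Matrix.specialUnitaryGroup (Fin 2) ℂ) :
    ∃ U ∈ Matrix.unitaryGroup (Fin 2) ℂ, ∃ d : Fin 2 → ℂ, W = U * Matrix.diagonal d * star U := by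
  obtain ⟨hWu, hWd⟩ := Matrix.mem_specialUnitaryGroup_iff.1 hW
  have hstar : star W = W.adjugate := by
    have h1 : W * star W = 1 := Matrix.mem_unitaryGroup_iff.1 hWu
    have h2 : W.adjugate * W = 1 := by rw [Matrix.adjugate_mul, hWd, one_smul]
    calc star W = W.adjugate * W * star W := by rw [h2, one_mul]
      _ = W.adjugate := by rw [mul_assoc, h1, mul_one]
  have hH : (Complex.I • (W - star W)).IsHermitian := by
    rw [Matrix.IsHermitian, Matrix.conjTranspose_smul, Matrix.conjTranspose_sub,
      Matrix.star_eq_conjTranspose, Matrix.conjTranspose_conjTranspose, Complex.star_def,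
      Complex.conj_I, neg_smul, ← smul_neg, neg_sub]
  obtain ⟨U, hU, e, he⟩ : ∃ U ∈ Matrix.unitaryGroup (Fin 2) ℂ, ∃ e : Fin 2 → ℂ,
      Complex.I • (W - star W) = U * Matrix.diagonal e * star U := by
    refine ⟨hH.eigenvectorUnitary, hH.eigenvectorUnitary.2, RCLike.ofReal ∘ hH.eigenvalues, ?_⟩
    have := hH.spectral_theorem
    rw [Unitary.conjStarAlgAut_apply] at this
    exact this
  have hUU : U * star U = 1 := Matrix.mem_unitaryGroup_iff.1 hU
  set c : ℂ := (W 0 0 + W 1 1) / 2 with hc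
  have hWc : W = c • (1 : Matrix (Fin 2) (Fin 2) ℂ) +
      (-Complex.I / 2) • (Complex.I • (W - star W)) := by
    rw [hstar, Matrix.adjugate_fin_two, smul_smul]
    have : -Complex.I / 2 * Complex.I = 1 / 2 := by
      linear_combination (-1 / 2 : ℂ) * Complex.I_mul_I
    rw [this]
    ext i j
    fin_cases i <;> fin_cases j <;> simp [hc] <;> ring
  refine ⟨U, hU, fun i => c + (-Complex.I / 2) * e i, ?_⟩
  have hd : Matrix.diagonal (fun i => c + (-Complex.I / 2) * e i) =
      c • (1 : Matrix (Fin 2) (Fin 2) ℂ) + (-Complex.I / 2) • Matrix.diagonal e := by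
    ext i j
    fin_cases i <;> fin_cases j <;> simp
  rw [hd, mul_add, add_mul, Matrix.mul_smul, Matrix.smul_mul, mul_one, hUU, Matrix.mul_smul,
    Matrix.smul_mul, ← he]
  exact hWc

/-- Every element of `SU(2)` is the square of a product of two conjugates of `X`. -/
lemma exists_reflections {W : Matrix (Fin 2) (Fin 2) ℂ}
    (hW : W ∈ Matrix.specialUnitaryGroup (Fin 2) ℂ) :
    ∃ A ∈ Matrix.unitaryGroup (Fin 2) ℂ, ∃ B ∈ Matrix.unitaryGroup (Fin 2) ℂ,
      (A * pauliX * star A) * (B * pauliX * star B) *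
        ((A * pauliX * star A) * (B * pauliX * star B)) = W := by
  obtain ⟨U, hU, d, hd⟩ := diagonalize_specialUnitary hW
  obtain ⟨hWu, hWd⟩ := Matrix.mem_specialUnitaryGroup_iff.1 hW
  have hUU : U * star U = 1 := Matrix.mem_unitaryGroup_iff.1 hU
  have hUU' : star U * U = 1 := Matrix.mem_unitaryGroup_iff'.1 hU
  have hdet : d 0 * d 1 = 1 := by
    have h := hWd
    rw [hd, Matrix.det_mul, Matrix.det_mul, mul_right_comm, ← Matrix.det_mul, hUU,
      Matrix.det_one, one_mul, Matrix.det_diagonal, Fin.prod_univ_two] at h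
    exact h
  have hdu : Matrix.diagonal d ∈ Matrix.unitaryGroup (Fin 2) ℂ := by
    have : Matrix.diagonal d = star U * W * U := by
      rw [hd]
      simp only [mul_assoc, hUU', mul_one]
      rw [← mul_assoc, hUU', one_mul]
    rw [this]
    exact mul_mem (mul_mem (Unitary.star_mem hU) hWu) hU
  have hd0 : ‖d 0‖ = 1 := by
    have h := congrFun (congrFun (Matrix.mem_unitaryGroup_iff.1 hdu) 0) 0
    rw [Matrix.star_eq_conjTranspose, Matrix.diagonal_conjTranspose,
      Matrix.diagonal_mul_diagonal, Matrix.diagonal_apply_eq, Matrix.one_apply_eq,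
      Pi.star_apply, Complex.star_def, Complex.mul_conj, Complex.normSq_eq_norm_sq] at h
    have h2 : ‖d 0‖ ^ 2 = 1 := by exact_mod_cast h
    exact (pow_eq_one_iff_of_nonneg (norm_nonneg _) two_ne_zero).1 h2
  obtain ⟨u, hu⟩ := IsAlgClosed.exists_pow_nat_eq (d 0) two_pos
  have hun : ‖u‖ = 1 := by
    rw [← hu, norm_pow] at hd0
    exact (pow_eq_one_iff_of_nonneg (norm_nonneg _) two_ne_zero).1 hd0
  have huu : u * star u = 1 := by
    rw [Complex.star_def, Complex.mul_conj, Complex.normSq_eq_norm_sq, hun]; simp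
  have hE : !![1, 0; 0, u] ∈ Matrix.unitaryGroup (Fin 2) ℂ := by
    rw [Matrix.mem_unitaryGroup_iff]
    ext i j
    fin_cases i <;> fin_cases j <;> simp [Matrix.mul_apply, Matrix.star_apply]
    simpa using huu
  -- X times its conjugate by diag(1, u) is diag(u, ū), whose square is the diagonal form of W when
  -- u² = d 0.
  have hkey : pauliX * (!![1, 0; 0, u] * pauliX * star !![1, 0; 0, u]) =
      !![u, 0; 0, star u] := by
    have hstar : star !![1, 0; 0, u] = !![1, 0; 0, star u] := by
      ext i j
      fin_cases i <;> fin_cases j <;> simp [Matrix.star_apply]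
    rw [hstar]
    ext i j
    fin_cases i <;> fin_cases j <;> simp [pauliX, Matrix.mul_apply]
  refine ⟨U, hU, U * !![1, 0; 0, u], mul_mem hU hE, ?_⟩
  have hPQ : (U * pauliX * star U) * (U * !![1, 0; 0, u] * pauliX * star (U * !![1, 0; 0, u])) =
      U * !![u, 0; 0, star u] * star U := by
    rw [← hkey, star_mul]
    simp only [mul_assoc]
    rw [← mul_assoc (star U) U, hUU', one_mul]
  rw [hPQ, hd]
  have hsq : (!![u, 0; 0, star u] : Matrix (Fin 2) (Fin 2) ℂ) * !![u, 0; 0, star u] =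
      Matrix.diagonal d := by
    have h0 : u * u = d 0 := by rw [← hu, sq]
    have h1 : star u * star u = d 1 := by
      have : d 0 * (star u * star u) = d 0 * d 1 := by
        rw [hdet, ← h0]
        linear_combination (u * star u + 1) * huu
      refine mul_left_cancel₀ ?_ this
      intro h
      rw [h] at hd0
      simp at hd0
    ext i j
    fin_cases i <;> fin_cases j <;> simp [Matrix.mul_apply, h0]
    simpa using h1
  rw [← hsq]
  simp only [mul_assoc]
  rw [← mul_assoc (star U) U, hUU', one_mul]

end SpecialUnitary

/-! ### Assembling the multi-controlled gate -/

section MultiControlled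

variable {ι : Type} [Fintype ι] [DecidableEq ι]

/-- A commutator of controlled reflections is controlled on the union of the control sets. -/
lemma controlledGate_union_eq {S T : Finset ι} {t : ι} (hS : t ∉ S) (hT : t ∉ T)
    {P Q : Matrix (Fin 2) (Fin 2) ℂ} (hP : P * P = 1) (hQ : Q * Q = 1) :
    controlledGate (S ∪ T) t (P * Q * (P * Q)) =
      controlledGate S t P * controlledGate T t Q *
        (controlledGate S t P * controlledGate T t Q) := by
  simp only [controlledGate_eq_blockGate]
  rw [blockGate_mul (indepOf_controls hS _ _) (indepOf_controls hT _ _), blockGate_mul]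
  · congr 1
    ext1 y
    have hiff : (∀ c ∈ S ∪ T, y c = 1) ↔ (∀ c ∈ S, y c = 1) ∧ ∀ c ∈ T, y c = 1 :=
      Finset.forall_mem_union
    -- If exactly one control set is satisfied, the word collapses to P² or Q².
    by_cases h1 : ∀ c ∈ S, y c = 1
    · by_cases h2 : ∀ c ∈ T, y c = 1
      · rw [if_pos h1, if_pos h2, if_pos (hiff.2 ⟨h1, h2⟩)]
      · rw [if_pos h1, if_neg h2, if_neg fun h => h2 (hiff.1 h).2, mul_one, hP]
    · by_cases h2 : ∀ c ∈ T, y c = 1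
      · rw [if_neg h1, if_pos h2, if_neg fun h => h1 (hiff.1 h).1, one_mul, hQ]
      · rw [if_neg h1, if_neg h2, if_neg fun h => h1 (hiff.1 h).1, one_mul, one_mul]
  · intro x b
    simp only [controls_update hS, controls_update hT]
  · intro x b
    simp only [controls_update hS, controls_update hT]

lemma implementable_controlled_reflection {S : Finset ι} {t : ι} (ht : t ∉ S) {D : ℕ}
    (h : PermImplementable Finset.univ D (toggle S t)) {A : Matrix (Fin 2) (Fin 2) ℂ}
    (hA : A ∈ Matrix.unitaryGroup (Fin 2) ℂ) :
    Implementable Finset.univ (D + 2) (controlledGate S t (A * pauliX * star A)) := by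
  rw [← controlledGate_conj ht (Matrix.mem_unitaryGroup_iff.1 hA), controlledGate_pauliX ht]
  exact (((implementable_single (Finset.mem_univ t) hA).mul h.1).mul
    (implementable_single (Finset.mem_univ t) (Unitary.star_mem hA))).mono subset_rfl (by omega)

/-- A NOT gate with fewer than `2 ^ J` controls has depth quadratic in `J`, given two further
bits if there are more than two controls. -/
lemma permImplementable_toggle_quadratic {J : ℕ} (hJ : 1 ≤ J) {S T : Finset ι} {t : ι}
    (hS : S.card ≤ 2 ^ J) (ht : t ∉ S) (htT : t ∉ T) (hST : Disjoint S T)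
    (hT : 3 ≤ S.card → 2 ≤ T.card) :
    PermImplementable Finset.univ (2036 * J ^ 2) (toggle S t) := by
  have hJ2 : J ≤ J ^ 2 := by nlinarith
  by_cases hS3 : 3 ≤ S.card
  · obtain ⟨P, hPT, hP⟩ := Finset.exists_subset_card_eq (hT hS3)
    obtain ⟨d, e, hde, rfl⟩ := Finset.card_eq_two.1 hP
    have hd : d ∈ T := hPT (by simp)
    have he : e ∈ T := hPT (by simp)
    have hlog : J < 2 ^ (Nat.log 2 J + 1) := Nat.lt_pow_succ_log_self (by norm_num) J
    have hpow : 2 ^ Nat.log 2 J ≤ J := Nat.pow_log_le_self 2 (by omega)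
    refine (permImplementable_toggle J (Nat.log 2 J + 1) hS3 hS hlog ht
      (Finset.disjoint_right.1 hST hd) (Finset.disjoint_right.1 hST he) hde
      (ne_of_mem_of_not_mem hd htT) (ne_of_mem_of_not_mem he htT)).mono subset_rfl ?_
    -- The number of flags is rounded up to a power of two that is at most 2J, so the dirty gate
    -- stays quadratic in J. Altogether 2·(76 + 40 + 45·4) + 1444 = 2036.
    have h4 : 4 ^ (Nat.log 2 J + 1) ≤ 4 * J ^ 2 := by
      rw [pow_succ, show (4 : ℕ) = 2 ^ 2 by norm_num, ← pow_mul, mul_comm 2, pow_mul, mul_comm]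
      exact Nat.mul_le_mul_left _ (Nat.pow_le_pow_left hpow 2)
    have h5 : J * (76 * J + 40) = 76 * J ^ 2 + 40 * J := by ring
    omega
  · exact (permImplementable_toggle_of_card_le_two ht (by omega) (Finset.subset_univ _)
      (Finset.mem_univ _)).mono subset_rfl (by simp only [toffoliDepth]; omega)

lemma implementable_multiControlled (n : ℕ) {W : Matrix (Fin 2) (Fin 2) ℂ}
    (hW : W ∈ Matrix.specialUnitaryGroup (Fin 2) ℂ) :
    Implementable Finset.univ (8152 * (Nat.log 2 n + 1) ^ 2 + 8) (multiControlled n W) := by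
  obtain ⟨A, hA, B, hB, hAB⟩ := exists_reflections hW
  set K : Finset (Fin (n + 1)) := Finset.univ.erase (Fin.last n) with hK
  have hKc : K.card = n := by simp [hK]
  have hlast : Fin.last n ∉ K := by simp [hK]
  -- With balanced halves, whenever one has at least three bits the other has the two dirty bits
  -- needed.
  obtain ⟨S, hSK, hS⟩ := Finset.exists_subset_card_eq (show n / 2 ≤ K.card by omega)
  have hTc : (K \ S).card = n - n / 2 := by rw [Finset.card_sdiff_of_subset hSK, hKc, hS]
  have htS : Fin.last n ∉ S := fun h => hlast (hSK h)
  have htT : Fin.last n ∉ K \ S := fun h => hlast (Finset.mem_sdiff.1 h).1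
  have hn : n < 2 ^ (Nat.log 2 n + 1) := Nat.lt_pow_succ_log_self (by norm_num) n
  have h1 := implementable_controlled_reflection htS (permImplementable_toggle_quadratic
    (J := Nat.log 2 n + 1) (by omega) (by omega) htS htT Finset.disjoint_sdiff (by omega)) hA
  have h2 := implementable_controlled_reflection htT (permImplementable_toggle_quadratic
    (J := Nat.log 2 n + 1) (by omega) (by omega) htT htS Finset.sdiff_disjoint (by omega)) hB
  have hrefl : ∀ V ∈ Matrix.unitaryGroup (Fin 2) ℂ,
      (V * pauliX * star V) * (V * pauliX * star V) = 1 := by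
    intro V hV
    have hX : pauliX * pauliX = 1 := by
      ext i j
      fin_cases i <;> fin_cases j <;> simp [pauliX, Matrix.mul_apply]
    calc (V * pauliX * star V) * (V * pauliX * star V)
        = V * (pauliX * (star V * V) * pauliX) * star V := by simp only [mul_assoc]
      _ = 1 := by
        rw [Matrix.mem_unitaryGroup_iff'.1 hV, mul_one, hX, mul_one,
          Matrix.mem_unitaryGroup_iff.1 hV]
  rw [multiControlled, ← hK, ← Finset.union_sdiff_of_subset hSK, ← hAB,
    controlledGate_union_eq htS htT (hrefl A hA) (hrefl B hB)]
  have h3 := h1.mul h2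
  exact (h3.mul h3).mono subset_rfl (by omega)

end MultiControlled

/-! ### Asymptotics of the depth bound -/

lemma isBigO_natLog_sq :
    (fun n : ℕ => ((8152 * (Nat.log 2 n + 1) ^ 2 + 8 : ℕ) : ℝ)) =O[atTop]
      (fun n : ℕ => Real.log (n : ℝ) ^ (2.799 : ℝ)) := by
  -- For n ≥ 3, L = log n is at least 1 and the binary logarithm is at most 2L, so its successor
  -- squared is at most 9L²; and 8160 = 8152 + 8.
  refine IsBigO.of_bound (8160 * 9) ?_
  filter_upwards [eventually_ge_atTop 3] with n hn
  have hlog : 1 ≤ Real.log n := by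
    rw [Real.le_log_iff_exp_le (by positivity)]
    have h3 : (3 : ℝ) ≤ n := by exact_mod_cast hn
    linarith [Real.exp_one_lt_d9]
  have hl2 : (1 / 2 : ℝ) < Real.log 2 := by linarith [Real.log_two_gt_d9]
  have hnat : (Nat.log 2 n : ℝ) ≤ 2 * Real.log n := by
    have h : (Nat.log 2 n : ℝ) * Real.log 2 ≤ Real.log n := by
      rw [← Real.log_pow]
      refine Real.log_le_log (by positivity) ?_
      exact_mod_cast Nat.pow_log_le_self 2 (by omega)
    have h0 : (0 : ℝ) ≤ Nat.log 2 n := Nat.cast_nonneg _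
    nlinarith
  have hsq : ((Nat.log 2 n : ℝ) + 1) ^ 2 ≤ 9 * Real.log n ^ 2 := by
    have h0 : (0 : ℝ) ≤ Nat.log 2 n := Nat.cast_nonneg _
    nlinarith
  have hone : 1 ≤ Real.log n ^ 2 := one_le_pow₀ hlog
  have hpow : Real.log n ^ 2 ≤ Real.log n ^ (2.799 : ℝ) := by
    rw [← Real.rpow_natCast]
    exact Real.rpow_le_rpow_of_exponent_le hlog (by norm_num)
  rw [Real.norm_of_nonneg (Nat.cast_nonneg _),
    Real.norm_of_nonneg (Real.rpow_nonneg (by linarith) _)]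
  push_cast
  linarith

end

theorem theorem2 :
    ∃ D : ℕ → ℕ,
      (fun n : ℕ => (D n : ℝ)) =O[atTop] (fun n : ℕ => Real.log (n : ℝ) ^ (2.799 : ℝ)) ∧
      ∀ (n : ℕ) (W : Matrix.specialUnitaryGroup (Fin 2) ℂ),
        ∃ C : QCircuit (Fin (n + 1)),
          QCircuit.toMatrix C = multiControlled n (W : Matrix (Fin 2) (Fin 2) ℂ) ∧
          QCircuit.depth C ≤ D n := by
  refine ⟨fun n => 8152 * (Nat.log 2 n + 1) ^ 2 + 8, isBigO_natLog_sq, fun n W => ?_⟩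
  obtain ⟨C, -, hM, hd⟩ := implementable_multiControlled n W.2
  exact ⟨C, hM, hd⟩
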